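/- **Lemma (Vanishing tails).** Let $k\in\mathbb N=\{0,1,2,\dots\}$ and $s\in(0,1)$ with $k+s>\tfrac12$. A *regular double-well potential* with constants $\alpha_W,\beta_W>0$ is a continuous $W\colon\mathbb R\to\mathbb R$ with $\alpha_W(1-|z|)^2\le W(z)\le\beta_W(1-|z|)^2$ for $|z|\le 2$ and $\inf_{|z|\ge 2}W(z)>0$. A *homogenization kernel* with bounds $\alpha_a,\beta_a$ is a measurable $a\colon\mathbb R^2\to\mathbb R$, $1$-periodic in both variables, with $0<\alpha_a\le a\le\beta_a<+\infty$ almost everywhere. For $v\in H^{k+s}_{\mathrm{loc}}(\mathbb R)$ (that is, on every bounded open interval the weak derivatives of $v$ of order $0,\dots,k$ are in $L^2$ and $\iint|v^{(k)}(x)-v^{(k)}(y)|^2|x-y|^{-1-2s}\,dx\,dy<\infty$) and an open interval $I$, put $$\Phi^a(v,I)=\int_I W(v(x))\,dx+\int_I\int_I a(x,y)\frac{|v^{(k)}(x)-v^{(k)}(y)|^2}{|x-y|^{1+2s}}\,dx\,dy,$$ $\Phi^a(v)=\Phi^a(v,\mathbb R)$ and $\Phi^a_T(v)=\Phi^a(v,(-T,T))$.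 Let $\alpha_W,\beta_W,\alpha_a,\beta_a$ be given, and let $\eta\in(0,1)$, $\rho>0$ and $M\in\mathbb R$. There is a constant $C>0$, depending only on $k,s,\alpha_W,\beta_W,\alpha_a,\beta_a,\eta,\rho$ and $M$, such that the following holds for every regular double-well potential $W$ with constants $\alpha_W,\beta_W$ and $\eta<\inf_{|z|>2}\sqrt{W(z)}$, and every homogenization kernel $a$ with bounds $\alpha_a,\beta_a$. Let $c'>c''>1$, let $\sigma\in\{1,-1\}$, and let $v\in H^{k+s}_{\mathrm{loc}}(\mathbb R)$ satisfy $$v(x)=\sigma\operatorname{sgn}(x)\ \text{ for a.e. }|x|\ge c',\qquad \big||v(x)|-1\big|\le\eta\ \text{ for a.e. }|x|\ge c''.$$ Then $\Phi^a(v)<+\infty$. If moreover $c''\ge\rho\,\Phi^a(v)$ and $\Phi^a(v)\le M$, then for every $T>\max\{c',3c''\}$: * if $k\ge1$, then $\displaystyle \Phi^a(v)-\Phi^a_T(v)\le C\Big(\frac{c''}{T-c'}\Big)^{2s}$; * if $k=0$ (so that $s>\tfrac12$), then $\displaystyle \Phi^a(v)-\Phi^a_T(v)\le C\Big(\frac{c'}{T-c'}\Big)^{2s}+\frac{C}{T^{2s-1}}$.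 -/

import Mathlib

open MeasureTheory Set
open scoped ENNReal ContDiff

noncomputable section

/-- `W` is a regular double-well potential with constants `αW, βW > 0`: it is continuous,
`αW (1 - |z|)² ≤ W z ≤ βW (1 - |z|)²` for `|z| ≤ 2`, and `inf_{|z| ≥ 2} W > 0`. -/
structure IsDoubleWell (W : ℝ → ℝ) (αW βW : ℝ) : Prop where
  continuous : Continuous W
  pos_lower : 0 < αW
  pos_upper : 0 < βW
  lower : ∀ z : ℝ, |z| ≤ 2 → αW * (1 - |z|) ^ 2 ≤ W z
  upper : ∀ z : ℝ, |z| ≤ 2 → W z ≤ βW * (1 - |z|) ^ 2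
  inf_pos : ∃ m : ℝ, 0 < m ∧ ∀ z : ℝ, 2 ≤ |z| → m ≤ W z

/-- `a` is a homogenization kernel, `1`-periodic in both variables, with essential bounds
`0 < αa ≤ a ≤ βa < ∞`. (One may take `αa`, `βa` to be the essential infimum and supremum.) -/
structure IsHomogenizationKernel (a : ℝ → ℝ → ℝ) (αa βa : ℝ) : Prop where
  aemeasurable : AEMeasurable (Function.uncurry a) (volume : Measure (ℝ × ℝ))
  periodic_left : ∀ x y : ℝ, a (x + 1) y = a x y
  periodic_right : ∀ x y : ℝ, a x (y + 1) = a x y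
  pos_lower : 0 < αa
  lower : ∀ᵐ p : ℝ × ℝ, αa ≤ a p.1 p.2
  upper : ∀ᵐ p : ℝ × ℝ, a p.1 p.2 ≤ βa

/-- `g` is a weak derivative of order `j` of `v` on `ℝ`. -/
structure HasWeakDeriv (j : ℕ) (v g : ℝ → ℝ) : Prop where
  locallyIntegrable : LocallyIntegrable v
  locallyIntegrable_deriv : LocallyIntegrable g
  integral_eq : ∀ φ : ℝ → ℝ, ContDiff ℝ ∞ φ → HasCompactSupport φ →
    ∫ x, v x * iteratedDeriv j φ x = (-1) ^ j * ∫ x, g x * φ x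

/-- Weak derivatives are unique almost everywhere. -/
theorem HasWeakDeriv.ae_eq {j : ℕ} {v g h : ℝ → ℝ} (hg : HasWeakDeriv j v g)
    (hh : HasWeakDeriv j v h) : g =ᵐ[volume] h := by
  refine ae_eq_of_integral_contDiff_smul_eq hg.locallyIntegrable_deriv
    hh.locallyIntegrable_deriv fun φ h1 h2 => ?_
  have e := (hg.integral_eq φ h1 h2).symm.trans (hh.integral_eq φ h1 h2)
  have e' := mul_left_cancel₀ (pow_ne_zero j (by norm_num : (-1 : ℝ) ≠ 0)) e
  simpa only [smul_eq_mul, mul_comm] using e'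

open Classical in
/-- A representative of the weak derivative `v^(j)` (it is unique up to null sets, and `v^(0) = v`
almost everywhere); by convention `0` if `v` has no weak derivative of order `j`. -/
def weakDeriv (j : ℕ) (v : ℝ → ℝ) : ℝ → ℝ :=
  if h : ∃ g : ℝ → ℝ, HasWeakDeriv j v g then h.choose else 0

/-- The weighted squared Gagliardo seminorm
`∫_I ∫_I a(x,y) |g(x) - g(y)|² / |x - y|^(1+2s) dx dy`, with values in `[0, ∞]`. -/
def gagliardo (a : ℝ → ℝ → ℝ) (s : ℝ) (g : ℝ → ℝ) (I : Set ℝ) : ℝ≥0∞ :=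
  ∫⁻ p in I ×ˢ I,
    ENNReal.ofReal (a p.1 p.2 * (|g p.1 - g p.2| ^ 2 / |p.1 - p.2| ^ (1 + 2 * s)))

/-- `v ∈ H^{k+s}_loc(ℝ)`: the weak derivatives of `v` of order `0, …, k` exist, they belong
to `L²` of every bounded open interval, and the one of order `k` has finite Gagliardo seminorm
of order `s` on every bounded open interval. -/
def MemHLoc (k : ℕ) (s : ℝ) (v : ℝ → ℝ) : Prop :=
  (∀ j ≤ k, HasWeakDeriv j v (weakDeriv j v) ∧
    ∀ R : ℝ, MemLp (weakDeriv j v) 2 (volume.restrict (Ioo (-R) R))) ∧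
  ∀ R : ℝ, gagliardo (fun _ _ => 1) s (weakDeriv k v) (Ioo (-R) R) < ⊤

/-- The rescaled functional
`Φ^a(v, I) = ∫_I W(v) dx + ∫_I ∫_I a(x,y) |v^(k)(x) - v^(k)(y)|² / |x - y|^(1+2s) dx dy`,
with values in `[0, ∞]` (both integrands are nonnegative almost everywhere). -/
def rescaledEnergy (W : ℝ → ℝ) (a : ℝ → ℝ → ℝ) (k : ℕ) (s : ℝ) (v : ℝ → ℝ) (I : Set ℝ) : ℝ≥0∞ :=
  (∫⁻ x in I, ENNReal.ofReal (W (v x))) + gagliardo a s (weakDeriv k v) I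

end

open MeasureTheory Set
open scoped ENNReal ContDiff

noncomputable section

/-! Write g for a measurable representative of `v^(k)`, c for `c'` and b for `c''`. Outside (-T, T)
the function `v` takes only the values ±1, where `W` vanishes, so the energy lost by truncation is
purely nonlocal: by `rescaledEnergy_univ_le` it is at most βa times the unweighted Gagliardo
integral over pairs (x, y) outside the square (-T, T)². By symmetry it suffices to bound twice the
strip |y| ≥ T.

If k ≥ 1, then g = 0 for |x| ≥ c, so only |x| < c contributes to the strip. There |x - y| ≥ T - c,
and integrating in y leaves a multiple of (T - c)^(-2s) ∫_{(-c,c)} g² (`tail_le_of_eq_zero`). The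
rate involves b rather than c because ∫ g² over (-c, c) is at most A b^(2s) Φ
(`exists_lintegral_weakDeriv_sq_le_rescaledEnergy`). On each half-line beyond b, the continuous
representative of `v` cannot vanish, hence keeps the sign of its limit τ = ±1; thus |v - τ| = |1 -
|v||, and the potential controls ∫ |v - τ|². On unit cells this and the seminorm control g in L²,
with a constant that does not depend on the number of cells. The core (-b, b) is then reached from
(b, 2b) by a fractional Poincaré inequality, which costs the factor b^(2s).

If k = 0, then g = v does not vanish at infinity. The part |x| < c is treated as before, with ∫ 2(g²
+ 1) of order c^(2s). Far pairs of equal sign cancel; far pairs of opposite sign have |x - y| ≥ |y|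
and give a multiple of ∫_{|y| ≥ T} |y|^(-2s) dy, that is T^(1-2s), which converges because s > 1/2
(`tail_le_of_eq_sign`).

Finiteness of Φ follows from the same tail bound at T = c + 1, because the energy on bounded
intervals is finite: `v` is locally bounded when k + s > 1/2. -/

/-- The density of the squared Gagliardo seminorm of order `s`. -/
def gagliardoDensity (s : ℝ) (g : ℝ → ℝ) (p : ℝ × ℝ) : ℝ≥0∞ :=
  ENNReal.ofReal (|g p.1 - g p.2| ^ 2 / |p.1 - p.2| ^ (1 + 2 * s))

/-! ### The unweighted Gagliardo density: comparison with the kernel, and symmetry. -/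

theorem measurable_gagliardoDensity (s : ℝ) {g : ℝ → ℝ} (hg : Measurable g) :
    Measurable (gagliardoDensity s g) := by
  unfold gagliardoDensity
  fun_prop

theorem gagliardoDensity_congr (s : ℝ) {g h : ℝ → ℝ} (hgh : g =ᵐ[volume] h) :
    gagliardoDensity s g =ᵐ[volume] gagliardoDensity s h := by
  have h1 := (Measure.quasiMeasurePreserving_fst (μ := (volume : Measure ℝ))
    (ν := (volume : Measure ℝ))).ae_eq_comp hgh
  have h2 := (Measure.quasiMeasurePreserving_snd (μ := (volume : Measure ℝ))
    (ν := (volume : Measure ℝ))).ae_eq_comp hgh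
  rw [Measure.volume_eq_prod]
  filter_upwards [h1, h2] with p hp1 hp2
  simp only [Function.comp_apply] at hp1 hp2
  simp only [gagliardoDensity, hp1, hp2]

theorem setLIntegral_weight_le {a : ℝ → ℝ → ℝ} {αa βa : ℝ} (ha : IsHomogenizationKernel a αa βa)
    (s : ℝ) (g : ℝ → ℝ) (S : Set (ℝ × ℝ)) :
    ∫⁻ p in S, ENNReal.ofReal (a p.1 p.2 * (|g p.1 - g p.2| ^ 2 / |p.1 - p.2| ^ (1 + 2 * s)))
      ≤ ENNReal.ofReal βa * ∫⁻ p in S, gagliardoDensity s g p := by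
  rw [← lintegral_const_mul' _ _ ENNReal.ofReal_ne_top]
  refine lintegral_mono_ae (ae_restrict_of_ae ?_)
  filter_upwards [ha.lower, ha.upper] with p h1 h2
  rw [gagliardoDensity, ← ENNReal.ofReal_mul (ha.pos_lower.le.trans (h1.trans h2))]
  exact ENNReal.ofReal_le_ofReal (mul_le_mul_of_nonneg_right h2 (by positivity))

theorem le_setLIntegral_weight {a : ℝ → ℝ → ℝ} {αa βa : ℝ} (ha : IsHomogenizationKernel a αa βa)
    (s : ℝ) (g : ℝ → ℝ) (S : Set (ℝ × ℝ)) :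
    ENNReal.ofReal αa * ∫⁻ p in S, gagliardoDensity s g p ≤
    ∫⁻ p in S, ENNReal.ofReal (a p.1 p.2 * (|g p.1 - g p.2| ^ 2 / |p.1 - p.2| ^ (1 + 2 * s))) := by
  rw [← lintegral_const_mul' _ _ ENNReal.ofReal_ne_top]
  refine lintegral_mono_ae (ae_restrict_of_ae ?_)
  filter_upwards [ha.lower] with p h1
  rw [gagliardoDensity, ← ENNReal.ofReal_mul ha.pos_lower.le]
  exact ENNReal.ofReal_le_ofReal (mul_le_mul_of_nonneg_right h1 (by positivity))

theorem gagliardoDensity_swap (s : ℝ) (g : ℝ → ℝ) (p : ℝ × ℝ) :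
    gagliardoDensity s g p.swap = gagliardoDensity s g p := by
  simp only [gagliardoDensity, Prod.fst_swap, Prod.snd_swap, abs_sub_comm]

theorem setLIntegral_gagliardoDensity_swap (s : ℝ) (g : ℝ → ℝ) (S : Set (ℝ × ℝ)) :
    ∫⁻ p in Prod.swap ⁻¹' S, gagliardoDensity s g p = ∫⁻ p in S, gagliardoDensity s g p := by
  have h : MeasurePreserving (Prod.swap : ℝ × ℝ → ℝ × ℝ) volume volume := by
    rw [Measure.volume_eq_prod]; exact Measure.measurePreserving_swap
  have e := h.setLIntegral_comp_preimage_emb MeasurableEquiv.prodComm.measurableEmbedding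
    (gagliardoDensity s g) S
  simpa only [gagliardoDensity_swap] using e

/-! ### Integrals of power kernels away from the singularity. -/

theorem lintegral_Ici_rpow {t r : ℝ} (ht : 1 < t) (hr : 0 < r) :
    ∫⁻ z in Ici r, ENNReal.ofReal (z ^ (-t)) = ENNReal.ofReal (r ^ (1 - t) / (t - 1)) := by
  rw [setLIntegral_congr Ioi_ae_eq_Ici.symm, ← ofReal_integral_eq_lintegral_ofReal
    (integrableOn_Ioi_rpow_of_lt (by linarith) hr)
    (ae_restrict_of_forall_mem measurableSet_Ioi fun x hx =>
      Real.rpow_nonneg (hr.le.trans (le_of_lt hx)) _), integral_Ioi_rpow_of_lt (by linarith) hr]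
  congr 1
  rw [show -t + 1 = -(t - 1) by ring, show -(t - 1) = 1 - t by ring, neg_div, ← div_neg, neg_sub]

theorem lintegral_abs_ge_rpow {t r : ℝ} (ht : 1 < t) (hr : 0 < r) :
    ∫⁻ z in {z : ℝ | r ≤ |z|}, ENNReal.ofReal (|z| ^ (-t))
      ≤ ENNReal.ofReal (2 * r ^ (1 - t) / (t - 1)) := by
  have hs : {z : ℝ | r ≤ |z|} = Ici r ∪ Neg.neg ⁻¹' Ici r := by
    ext z; simp [le_abs, le_neg]
  have h1 : ∫⁻ z in Ici r, ENNReal.ofReal (|z| ^ (-t)) =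
      ENNReal.ofReal (r ^ (1 - t) / (t - 1)) := by
    rw [← lintegral_Ici_rpow ht hr]
    refine setLIntegral_congr_fun measurableSet_Ici fun z hz => ?_
    simp only [abs_of_nonneg (hr.le.trans hz)]
  have h2 : ∫⁻ z in Neg.neg ⁻¹' Ici r, ENNReal.ofReal (|z| ^ (-t)) =
      ∫⁻ z in Ici r, ENNReal.ofReal (|z| ^ (-t)) := by
    have e := (Measure.measurePreserving_neg (volume : Measure ℝ)).setLIntegral_comp_preimage_emb
      (MeasurableEquiv.neg ℝ).measurableEmbedding (fun z => ENNReal.ofReal (|z| ^ (-t))) (Ici r)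
    simpa only [abs_neg] using e
  have hnn : 0 ≤ r ^ (1 - t) / (t - 1) := div_nonneg (Real.rpow_nonneg hr.le _) (by linarith)
  rw [hs]
  refine (lintegral_union_le _ _ _).trans ?_
  rw [h2, h1, ← ENNReal.ofReal_add hnn hnn]
  exact ENNReal.ofReal_le_ofReal (le_of_eq (by ring))

theorem lintegral_abs_sub_ge_rpow {t r : ℝ} (ht : 1 < t) (hr : 0 < r) (x : ℝ) :
    ∫⁻ y in {y : ℝ | r ≤ |x - y|}, ENNReal.ofReal (|x - y| ^ (-t))
      ≤ ENNReal.ofReal (2 * r ^ (1 - t) / (t - 1)) := by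
  refine le_of_eq_of_le ?_ (lintegral_abs_ge_rpow ht hr)
  exact (Measure.measurePreserving_sub_left (volume : Measure ℝ) x).setLIntegral_comp_preimage_emb
    (MeasurableEquiv.subLeft x).measurableEmbedding
    (fun z => ENNReal.ofReal (|z| ^ (-t))) {z : ℝ | r ≤ |z|}

/-! ### Nonlocal tails outside a square. -/

theorem setLIntegral_compl_square_gagliardoDensity_le (s : ℝ) (g : ℝ → ℝ) (T : ℝ) :
    ∫⁻ p in (Ioo (-T) T ×ˢ Ioo (-T) T)ᶜ, gagliardoDensity s g p ≤
      2 * ∫⁻ p in univ ×ˢ {y : ℝ | T ≤ |y|}, gagliardoDensity s g p := by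
  set A : Set (ℝ × ℝ) := univ ×ˢ {y : ℝ | T ≤ |y|} with hA
  have hsub : (Ioo (-T) T ×ˢ Ioo (-T) T)ᶜ ⊆ A ∪ Prod.swap ⁻¹' A := by
    intro p hp
    by_contra h
    simp only [hA, mem_union, mem_prod, mem_univ, true_and, mem_ofPred_eq, mem_preimage,
      Prod.snd_swap, not_or, not_le, abs_lt] at h
    exact hp ⟨h.2, h.1⟩
  refine (lintegral_mono_set hsub).trans ((lintegral_union_le _ _ _).trans ?_)
  rw [setLIntegral_gagliardoDensity_swap, two_mul]

theorem gagliardoDensity_le {s : ℝ} {g : ℝ → ℝ} {p : ℝ × ℝ} {b : ℝ}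
    (h : |g p.1 - g p.2| ^ 2 ≤ b) :
    gagliardoDensity s g p ≤ ENNReal.ofReal b * ENNReal.ofReal (|p.1 - p.2| ^ (-(1 + 2 * s))) := by
  rw [gagliardoDensity, ← ENNReal.ofReal_mul ((by positivity : (0:ℝ) ≤ _).trans h),
    Real.rpow_neg (abs_nonneg _), ← div_eq_mul_inv]
  exact ENNReal.ofReal_le_ofReal (by gcongr)

theorem measurableSet_le_abs (T : ℝ) : MeasurableSet {y : ℝ | T ≤ |y|} :=
  measurableSet_le measurable_const measurable_norm

/-- Points with |x| < c and |y| ≥ T are at distance at least T - c, so by Tonelli the inner integral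
in y is a power tail starting at T - c, uniformly in x. -/
theorem lintegral_strip_le {s c T : ℝ} (hs : 0 < s) (hT : c < T) {F : ℝ → ℝ≥0∞}
    (hF : Measurable F) :
    ∫⁻ p in Ioo (-c) c ×ˢ {y : ℝ | T ≤ |y|},
        F p.1 * ENNReal.ofReal (|p.1 - p.2| ^ (-(1 + 2 * s))) ≤
      ENNReal.ofReal ((T - c) ^ (-(2 * s)) / s) * ∫⁻ x in Ioo (-c) c, F x := by
  rw [Measure.volume_eq_prod, ← Measure.prod_restrict, lintegral_prod _
    (by fun_prop),
    ← lintegral_const_mul _ hF]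
  refine setLIntegral_mono' measurableSet_Ioo fun x hx => ?_
  simp only
  rw [lintegral_const_mul _ (by fun_prop), mul_comm]
  gcongr
  have hsub : {y : ℝ | T ≤ |y|} ⊆ {y : ℝ | T - c ≤ |x - y|} := by
    intro y hy
    have h1 : |x| < c := abs_lt.2 hx
    have h2 := abs_sub_abs_le_abs_sub y x
    rw [abs_sub_comm] at h2
    simp only [mem_ofPred_eq] at hy ⊢
    linarith
  refine (lintegral_mono_set hsub).trans ((lintegral_abs_sub_ge_rpow (by linarith)
    (by linarith) x).trans (ENNReal.ofReal_le_ofReal (le_of_eq ?_)))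
  rw [show 1 - (1 + 2 * s) = -(2 * s) by ring]
  field_simp
  ring

theorem setLIntegral_strip_split (f : ℝ × ℝ → ℝ≥0∞) (c T : ℝ) :
    ∫⁻ p in univ ×ˢ {y : ℝ | T ≤ |y|}, f p ≤ (∫⁻ p in Ioo (-c) c ×ˢ {y : ℝ | T ≤ |y|}, f p) +
      ∫⁻ p in {x : ℝ | c ≤ |x|} ×ˢ {y : ℝ | T ≤ |y|}, f p := by
  refine (lintegral_mono_set ?_).trans (lintegral_union_le _ _ _)
  rintro ⟨x, y⟩ ⟨-, hy⟩
  rcases lt_or_ge (|x|) c with h | h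
  · exact Or.inl ⟨abs_lt.1 h, hy⟩
  · exact Or.inr ⟨h, hy⟩

/-- Off-diagonal tail for a function vanishing outside `(-c, c)`. -/
theorem tail_le_of_eq_zero {s c T : ℝ} (hs : 0 < s) (hT : c < T) {g : ℝ → ℝ}
    (hg : Measurable g) (h0 : ∀ᵐ x : ℝ, c ≤ |x| → g x = 0) :
    ∫⁻ p in (Ioo (-T) T ×ˢ Ioo (-T) T)ᶜ, gagliardoDensity s g p ≤
      2 * (ENNReal.ofReal ((T - c) ^ (-(2 * s)) / s) *
        ∫⁻ x in Ioo (-c) c, ENNReal.ofReal (g x ^ 2)) := by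
  have h1 := (Measure.quasiMeasurePreserving_fst (μ := (volume : Measure ℝ))
    (ν := (volume : Measure ℝ))).ae h0
  have h2 := (Measure.quasiMeasurePreserving_snd (μ := (volume : Measure ℝ))
    (ν := (volume : Measure ℝ))).ae h0
  rw [← Measure.volume_eq_prod] at h1 h2
  refine (setLIntegral_compl_square_gagliardoDensity_le s g T).trans ?_
  gcongr
  refine (setLIntegral_strip_split _ c T).trans ?_
  have hz : ∫⁻ p in {x : ℝ | c ≤ |x|} ×ˢ {y : ℝ | T ≤ |y|}, gagliardoDensity s g p = 0 := by
    rw [← nonpos_iff_eq_zero, ← lintegral_zero (μ := volume.restrict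
      ({x : ℝ | c ≤ |x|} ×ˢ {y : ℝ | T ≤ |y|}))]
    refine setLIntegral_mono_ae' ((measurableSet_le_abs c).prod (measurableSet_le_abs T)) ?_
    filter_upwards [h1, h2] with p hp1 hp2 hp
    simp [gagliardoDensity, hp1 hp.1, hp2 (hT.le.trans hp.2)]
  rw [hz, add_zero]
  refine le_trans ?_ (lintegral_strip_le hs hT (F := fun x => ENNReal.ofReal (g x ^ 2))
    (by fun_prop))
  refine setLIntegral_mono_ae' (measurableSet_Ioo.prod (measurableSet_le_abs T)) ?_
  filter_upwards [h2] with p hp2 hp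
  refine gagliardoDensity_le ?_
  rw [hp2 (hT.le.trans hp.2), sub_zero, sq_abs]

/-- Models the interaction of far points of opposite sign, where |x - y| ≥ |y| and the squared jump
is 4. Integrating first in x gives a multiple of |y|^(-2s), integrable at infinity because s > 1/2.
-/
theorem lintegral_opposite_le {s T : ℝ} (hs : 1 / 2 < s) (hT : 0 < T) :
    ∫⁻ p in univ ×ˢ {y : ℝ | T ≤ |y|}, {p : ℝ × ℝ | |p.2| ≤ |p.1 - p.2|}.indicator
      (fun p => ENNReal.ofReal 4 * ENNReal.ofReal (|p.1 - p.2| ^ (-(1 + 2 * s)))) p ≤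
      ENNReal.ofReal (8 / (s * (2 * s - 1)) * T ^ (1 - 2 * s)) := by
  have hs0 : 0 < s := by linarith
  have hmS : MeasurableSet {p : ℝ × ℝ | |p.2| ≤ |p.1 - p.2|} :=
    measurableSet_le (by fun_prop) (by fun_prop)
  have hm : Measurable ({p : ℝ × ℝ | |p.2| ≤ |p.1 - p.2|}.indicator
      (fun p => ENNReal.ofReal 4 * ENNReal.ofReal (|p.1 - p.2| ^ (-(1 + 2 * s))))) :=
    (by fun_prop : Measurable fun p : ℝ × ℝ =>
      ENNReal.ofReal 4 * ENNReal.ofReal (|p.1 - p.2| ^ (-(1 + 2 * s)))).indicator hmS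
  rw [Measure.volume_eq_prod, ← Measure.prod_restrict, lintegral_prod_symm _ hm.aemeasurable]
  have key : ∀ y ∈ {y : ℝ | T ≤ |y|}, ∫⁻ x in univ, {p : ℝ × ℝ | |p.2| ≤ |p.1 - p.2|}.indicator
      (fun p => ENNReal.ofReal 4 * ENNReal.ofReal (|p.1 - p.2| ^ (-(1 + 2 * s)))) (x, y) ≤
      ENNReal.ofReal (4 / s) * ENNReal.ofReal (|y| ^ (-(2 * s))) := by
    intro y hy
    have hy0 : 0 < |y| := hT.trans_le hy
    have e : ∀ x : ℝ, {p : ℝ × ℝ | |p.2| ≤ |p.1 - p.2|}.indicator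
      (fun p => ENNReal.ofReal 4 * ENNReal.ofReal (|p.1 - p.2| ^ (-(1 + 2 * s)))) (x, y) =
      {x : ℝ | |y| ≤ |y - x|}.indicator
        (fun x => ENNReal.ofReal 4 * ENNReal.ofReal (|y - x| ^ (-(1 + 2 * s)))) x := by
      intro x
      simp only [indicator, mem_ofPred_eq, abs_sub_comm x y]
    simp_rw [e]
    rw [Measure.restrict_univ, lintegral_indicator (measurableSet_le (by fun_prop) (by fun_prop)),
      lintegral_const_mul _ (by fun_prop)]
    refine (mul_le_mul_right (lintegral_abs_sub_ge_rpow (by linarith) hy0 y) _).trans ?_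
    rw [← ENNReal.ofReal_mul (by norm_num), ← ENNReal.ofReal_mul (by positivity)]
    refine ENNReal.ofReal_le_ofReal (le_of_eq ?_)
    rw [show 1 - (1 + 2 * s) = -(2 * s) by ring]
    field_simp
    ring
  refine (setLIntegral_mono' (measurableSet_le_abs T) key).trans ?_
  rw [lintegral_const_mul _ (by fun_prop)]
  refine (mul_le_mul_right (lintegral_abs_ge_rpow (by linarith) hT) _).trans ?_
  rw [← ENNReal.ofReal_mul (by positivity)]
  refine ENNReal.ofReal_le_ofReal (le_of_eq ?_)
  have : 2 * s - 1 ≠ 0 := by linarith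
  field_simp
  ring

/-- Off-diagonal tail for a function equal to `± sgn` outside `(-c, c)`. -/
theorem tail_le_of_eq_sign {s c T σ : ℝ} (hs : 1 / 2 < s) (hc : 0 < c) (hT : c < T)
    (hσ : σ = 1 ∨ σ = -1) {g : ℝ → ℝ} (hg : Measurable g)
    (h0 : ∀ᵐ x : ℝ, c ≤ |x| → g x = σ * Real.sign x) :
    ∫⁻ p in (Ioo (-T) T ×ˢ Ioo (-T) T)ᶜ, gagliardoDensity s g p ≤
      2 * (ENNReal.ofReal ((T - c) ^ (-(2 * s)) / s) *
        (∫⁻ x in Ioo (-c) c, ENNReal.ofReal (2 * (g x ^ 2 + 1))) +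
        ENNReal.ofReal (8 / (s * (2 * s - 1)) * T ^ (1 - 2 * s))) := by
  have h1 := (Measure.quasiMeasurePreserving_fst (μ := (volume : Measure ℝ))
    (ν := (volume : Measure ℝ))).ae h0
  have h2 := (Measure.quasiMeasurePreserving_snd (μ := (volume : Measure ℝ))
    (ν := (volume : Measure ℝ))).ae h0
  rw [← Measure.volume_eq_prod] at h1 h2
  refine (setLIntegral_compl_square_gagliardoDensity_le s g T).trans ?_
  gcongr
  refine (setLIntegral_strip_split _ c T).trans (add_le_add ?_ ?_)
  · refine le_trans ?_ (lintegral_strip_le (by linarith : 0 < s) hT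
      (F := fun x => ENNReal.ofReal (2 * (g x ^ 2 + 1))) (by fun_prop))
    refine setLIntegral_mono_ae' (measurableSet_Ioo.prod (measurableSet_le_abs T)) ?_
    filter_upwards [h2] with p hp2 hp
    refine gagliardoDensity_le ?_
    -- With g(y)² ≤ 1, the inequality (g(x) - g(y))² ≤ 2g(x)² + 2g(y)² gives the weight 2(g(x)² +
    -- 1).
    have hsq : g p.2 ^ 2 ≤ 1 := by
      rw [hp2 (hT.le.trans hp.2)]
      rcases hσ with rfl | rfl <;>
        rcases Real.sign_apply_eq p.2 with h | h | h <;> rw [h] <;> norm_num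
    rw [sq_abs]
    nlinarith [sq_nonneg (g p.1 + g p.2)]
  · refine le_trans ?_ (lintegral_opposite_le hs (hc.trans hT))
    refine le_trans (setLIntegral_mono_ae' ((measurableSet_le_abs c).prod (measurableSet_le_abs T))
      ?_) (lintegral_mono_set (prod_mono_left (subset_univ _)))
    filter_upwards [h1, h2] with p hp1 hp2 hp
    have e1 := hp1 hp.1
    have e2 := hp2 (hT.le.trans hp.2)
    have hx : p.1 ≠ 0 := fun h => by
      have := hp.1; simp only [mem_ofPred_eq, h, abs_zero] at this; linarith
    have hy : p.2 ≠ 0 := fun h => by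
      have := hp.2; simp only [mem_ofPred_eq, h, abs_zero] at this; linarith
    by_cases hsg : Real.sign p.1 = Real.sign p.2
    · simp [gagliardoDensity, e1, e2, hsg]
    · have hmem : |p.2| ≤ |p.1 - p.2| := by
        rcases lt_or_gt_of_ne hx with hx | hx <;> rcases lt_or_gt_of_ne hy with hy | hy
        · simp [Real.sign_of_neg hx, Real.sign_of_neg hy] at hsg
        · rw [abs_of_pos hy, abs_of_neg (by linarith)]; linarith
        · rw [abs_of_neg hy, abs_of_pos (by linarith)]; linarith
        · simp [Real.sign_of_pos hx, Real.sign_of_pos hy] at hsg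
      rw [indicator_of_mem (by exact hmem)]
      refine gagliardoDensity_le ?_
      rw [e1, e2, sq_abs]
      rcases hσ with rfl | rfl <;> rcases Real.sign_apply_eq p.1 with h | h | h <;>
        rcases Real.sign_apply_eq p.2 with h' | h' | h' <;> rw [h, h'] <;> norm_num

/-! ### Cauchy–Schwarz and the fractional Poincaré inequality. -/

theorem sq_lintegral_le {α : Type*} [MeasurableSpace α] (μ : Measure α) {f : α → ℝ≥0∞}
    (hf : AEMeasurable f μ) : (∫⁻ x, f x ∂μ) ^ 2 ≤ μ univ * ∫⁻ x, f x ^ 2 ∂μ := by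
  have h := ENNReal.lintegral_mul_le_Lp_mul_Lq μ Real.HolderConjugate.two_two hf
    (aemeasurable_const (b := (1 : ℝ≥0∞)))
  simp only [Pi.mul_apply, mul_one, ENNReal.one_rpow, lintegral_const, one_mul] at h
  have key : ∀ z : ℝ≥0∞, (z ^ (1 / 2 : ℝ)) ^ 2 = z := fun z => by
    rw [← ENNReal.rpow_natCast, ← ENNReal.rpow_mul]; norm_num
  have h2 := pow_le_pow_left' h 2
  rw [mul_pow, key, key, mul_comm] at h2
  simpa using h2

theorem enorm_sub_sq_le_gagliardoDensity {s D : ℝ} (hs : 0 < s) (g : ℝ → ℝ) {x y : ℝ}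
    (hxy : |x - y| ≤ D) :
    ‖g x - g y‖ₑ ^ 2 ≤ ENNReal.ofReal (D ^ (1 + 2 * s)) * gagliardoDensity s g (x, y) := by
  rw [gagliardoDensity, ← ENNReal.ofReal_mul (Real.rpow_nonneg ((abs_nonneg _).trans hxy) _),
    Real.enorm_eq_ofReal_abs, ← ENNReal.ofReal_pow (abs_nonneg _)]
  refine ENNReal.ofReal_le_ofReal ?_
  rcases eq_or_ne x y with rfl | hne
  · simp
  have hpos : 0 < |x - y| := abs_pos.2 (sub_ne_zero.2 hne)
  have h1 : |x - y| ^ (1 + 2 * s) ≤ D ^ (1 + 2 * s) :=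
    Real.rpow_le_rpow hpos.le hxy (by linarith)
  have h2 : 0 < |x - y| ^ (1 + 2 * s) := Real.rpow_pos_of_pos hpos _
  simp only
  rw [mul_div_assoc', le_div_iff₀ h2, mul_comm]
  gcongr

theorem enorm_add_sq_le (a b : ℝ) : ‖a + b‖ₑ ^ 2 ≤ 2 * ‖a‖ₑ ^ 2 + 2 * ‖b‖ₑ ^ 2 := by
  simp only [Real.enorm_eq_ofReal_abs, ← ENNReal.ofReal_pow (abs_nonneg _), sq_abs]
  rw [show (2 : ℝ≥0∞) = ENNReal.ofReal 2 by simp, ← ENNReal.ofReal_mul (by norm_num),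
    ← ENNReal.ofReal_mul (by norm_num), ← ENNReal.ofReal_add (by positivity) (by positivity)]
  exact ENNReal.ofReal_le_ofReal (by nlinarith [sq_nonneg (a - b)])

theorem setLIntegral_prod_fst {f : ℝ → ℝ≥0∞} (hf : Measurable f) (A B : Set ℝ) :
    ∫⁻ p in A ×ˢ B, f p.1 = volume B * ∫⁻ x in A, f x := by
  rw [Measure.volume_eq_prod, ← Measure.prod_restrict, lintegral_prod _ (by fun_prop)]
  simp only [lintegral_const, Measure.restrict_apply_univ]
  rw [lintegral_mul_const _ hf, mul_comm]

theorem setLIntegral_prod_snd {f : ℝ → ℝ≥0∞} (hf : Measurable f) (A B : Set ℝ) :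
    ∫⁻ p in A ×ˢ B, f p.2 = volume A * ∫⁻ x in B, f x := by
  rw [Measure.volume_eq_prod, ← Measure.prod_restrict, lintegral_prod _ (by fun_prop)]
  simp only [lintegral_const, Measure.restrict_apply_univ]
  rw [mul_comm]

/-- Integrate g(x)² ≤ 2(g(x) - g(y))² + 2g(y)² over A × B; the first term is at most D^(1+2s) times
the density because all distances between A and B are at most D. -/
theorem volume_mul_lintegral_sq_le {s D : ℝ} (hs : 0 < s) {g : ℝ → ℝ} (hg : Measurable g)
    {A B : Set ℝ} (hA : MeasurableSet A) (hB : MeasurableSet B)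
    (hD : ∀ x ∈ A, ∀ y ∈ B, |x - y| ≤ D) :
    volume B * ∫⁻ x in A, ‖g x‖ₑ ^ 2 ≤
      2 * (ENNReal.ofReal (D ^ (1 + 2 * s)) * ∫⁻ p in A ×ˢ B, gagliardoDensity s g p) +
      2 * (volume A * ∫⁻ y in B, ‖g y‖ₑ ^ 2) := by
  have hm : Measurable fun x => ‖g x‖ₑ ^ 2 := by fun_prop
  have hk := measurable_gagliardoDensity s hg
  rw [← setLIntegral_prod_fst hm, ← setLIntegral_prod_snd hm, ← lintegral_const_mul _ hk,
    ← lintegral_const_mul _ (by fun_prop), ← lintegral_const_mul _ (by fun_prop),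
    ← lintegral_add_left (by fun_prop)]
  refine setLIntegral_mono' (hA.prod hB) fun p hp => ?_
  have h := enorm_add_sq_le (g p.1 - g p.2) (g p.2)
  rw [sub_add_cancel] at h
  refine h.trans ?_
  gcongr
  exact enorm_sub_sq_le_gagliardoDensity hs g (hD _ hp.1 _ hp.2)

/-- A fractional Poincaré inequality: the `L²` norm on `(-c, c)` is controlled by the Gagliardo
seminorm and the `L²` norm on `(c, 2c)`. -/
theorem lintegral_sq_le_poincare {s c : ℝ} (hs : 0 < s) (hc : 0 < c) {g : ℝ → ℝ}
    (hg : Measurable g) :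
    ∫⁻ x in Ioo (-c) c, ‖g x‖ₑ ^ 2 ≤
      ENNReal.ofReal (2 * 3 ^ (1 + 2 * s) * c ^ (2 * s)) * (∫⁻ p, gagliardoDensity s g p) +
      4 * ∫⁻ y in Ioo c (2 * c), ‖g y‖ₑ ^ 2 := by
  -- Points of (-c, c) and (c, 2c) are at distance at most 3c. Dividing by the length c of the
  -- second interval turns (3c)^(1+2s) into a multiple of c^(2s).
  have h := volume_mul_lintegral_sq_le (D := 3 * c) hs hg (measurableSet_Ioo (a := -c) (b := c))
    (measurableSet_Ioo (a := c) (b := 2 * c)) fun x hx y hy => by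
      rw [abs_le]; constructor <;> linarith [hx.1, hx.2, hy.1, hy.2]
  rw [Real.volume_Ioo, Real.volume_Ioo, show 2 * c - c = c by ring, show c - -c = 2 * c by ring]
    at h
  have hc0 : ENNReal.ofReal c ≠ 0 := by simpa using hc
  refine (ENNReal.mul_le_mul_iff_right hc0 ENNReal.ofReal_ne_top).1 (h.trans ?_)
  rw [mul_add]
  refine add_le_add ?_ (le_of_eq ?_)
  · rw [← mul_assoc, ← mul_assoc]
    refine mul_le_mul' (le_of_eq ?_) (setLIntegral_le_lintegral _ _)
    rw [show (2 : ℝ≥0∞) = ENNReal.ofReal 2 by simp, ← ENNReal.ofReal_mul (by norm_num),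
      ← ENNReal.ofReal_mul hc.le, Real.mul_rpow (by norm_num) hc.le, Real.rpow_add hc,
      Real.rpow_one]
    congr 1; ring
  · rw [ENNReal.ofReal_mul (by norm_num)]
    simp only [ENNReal.ofReal_ofNat]
    ring

/-! ### Test functions and L² bounds for weak derivatives on unit cells. -/

theorem HasCompactSupport.iteratedDeriv {φ : ℝ → ℝ} (hc : HasCompactSupport φ) (k : ℕ) :
    HasCompactSupport (iteratedDeriv k φ) := by
  induction k with
  | zero => simpa using hc
  | succ k ih => rw [iteratedDeriv_succ]; exact ih.deriv

theorem ContDiff.contDiff_iteratedDeriv {φ : ℝ → ℝ} (hφ : ContDiff ℝ ∞ φ) (k : ℕ) :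
    ContDiff ℝ ∞ (iteratedDeriv k φ) := by
  induction k with
  | zero => simpa using hφ
  | succ k ih => rw [iteratedDeriv_succ]; exact (contDiff_infty_iff_deriv.1 ih).2

theorem integral_iteratedDeriv_eq_zero {φ : ℝ → ℝ} (hφ : ContDiff ℝ ∞ φ)
    (hc : HasCompactSupport φ) {k : ℕ} (hk : 1 ≤ k) : ∫ x, iteratedDeriv k φ x = 0 := by
  obtain ⟨j, rfl⟩ : ∃ j, k = j + 1 := ⟨k - 1, by omega⟩
  have hj := hφ.contDiff_iteratedDeriv j
  refine integral_eq_zero_of_hasDerivAt_of_integrable (f := iteratedDeriv j φ)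
    (fun x => ?_) ?_ ?_
  · rw [iteratedDeriv_succ]
    exact (hj.differentiable (by simp) x).hasDerivAt
  · exact (hφ.contDiff_iteratedDeriv _).continuous.integrable_of_hasCompactSupport
      (hc.iteratedDeriv _)
  · exact hj.continuous.integrable_of_hasCompactSupport (hc.iteratedDeriv _)

theorem support_iteratedDeriv_subset_tsupport (φ : ℝ → ℝ) (k : ℕ) :
    Function.support (iteratedDeriv k φ) ⊆ tsupport φ := by
  refine subset_trans (fun x hx => ?_) (support_iteratedFDeriv_subset (𝕜 := ℝ) k (f := φ))
  rw [Function.mem_support] at hx ⊢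
  rwa [← norm_ne_zero_iff, norm_iteratedFDeriv_eq_norm_iteratedDeriv, norm_ne_zero_iff]

/-- Normalized test functions on all the unit intervals, with common bounds. -/
theorem exists_testFunction_unit_interval (k : ℕ) :
    ∃ B : ℝ, 0 < B ∧ ∀ b : ℝ, ∃ φ : ℝ → ℝ, ContDiff ℝ ∞ φ ∧ HasCompactSupport φ ∧
      ∫ x, φ x = 1 ∧ tsupport φ ⊆ Ioo b (b + 1) ∧ (∀ x, |φ x| ≤ B) ∧
      ∀ x, |iteratedDeriv k φ x| ≤ B := by
  -- One fixed bump supported in [1/4, 3/4]; its translates by b give bounds independent of b.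
  let f : ContDiffBump (1 / 2 : ℝ) := ⟨1 / 8, 1 / 4, by norm_num, by norm_num⟩
  let ψ : ℝ → ℝ := f.normed volume
  have hψ : ContDiff ℝ ∞ ψ := f.contDiff_normed
  have hψc : HasCompactSupport ψ := f.hasCompactSupport_normed
  obtain ⟨B₁, hB₁⟩ := hψ.continuous.bounded_above_of_compact_support hψc
  obtain ⟨B₂, hB₂⟩ := (hψ.contDiff_iteratedDeriv k).continuous.bounded_above_of_compact_support
    (hψc.iteratedDeriv k)
  refine ⟨max 1 (max B₁ B₂), by positivity, fun b => ⟨fun x => ψ (x - b), by fun_prop, ?_, ?_, ?_,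
    fun x => (hB₁ _).trans (by simp), fun x => ?_⟩⟩
  · exact hψc.comp_homeomorph (Homeomorph.subRight b)
  · rw [integral_sub_right_eq_self (μ := volume) ψ b]
    exact f.integral_normed
  · have e : tsupport (fun x => ψ (x - b)) = (Homeomorph.subRight b) ⁻¹' tsupport ψ :=
      tsupport_comp_eq_preimage ψ (Homeomorph.subRight b)
    rw [e, f.tsupport_normed_eq]
    intro x hx
    have hx' : |x - b - 1 / 2| ≤ 1 / 4 := hx
    rw [abs_le] at hx'
    constructor <;> linarith [hx'.1, hx'.2]
  · rw [iteratedDeriv_comp_sub_const]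
    exact (hB₂ _).trans (by simp)

theorem enorm_integral_mul_sq_le {b B : ℝ} {F φ : ℝ → ℝ} (hF : AEMeasurable F)
    (hs : Function.support φ ⊆ Ico b (b + 1)) (hφ : ∀ x, |φ x| ≤ B) :
    ‖∫ y, F y * φ y‖ₑ ^ 2 ≤ ENNReal.ofReal B ^ 2 * ∫⁻ y in Ico b (b + 1), ‖F y‖ₑ ^ 2 := by
  have h1 : ∫ y, F y * φ y = ∫ y in Ico b (b + 1), F y * φ y := by
    refine (setIntegral_eq_integral_of_forall_compl_eq_zero fun y hy => ?_).symm
    rw [Function.notMem_support.1 fun h => hy (hs h), mul_zero]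
  have h2 : ‖∫ y, F y * φ y‖ₑ ≤ ENNReal.ofReal B * ∫⁻ y in Ico b (b + 1), ‖F y‖ₑ := by
    rw [h1, ← lintegral_const_mul' _ _ ENNReal.ofReal_ne_top]
    refine (enorm_integral_le_lintegral_enorm _).trans (lintegral_mono fun y => ?_)
    rw [enorm_mul, mul_comm]
    gcongr
    rw [Real.enorm_eq_ofReal_abs]
    exact ENNReal.ofReal_le_ofReal (hφ y)
  refine (pow_le_pow_left' h2 2).trans ?_
  rw [mul_pow]
  gcongr
  refine (sq_lintegral_le _ hF.enorm.restrict).trans (le_of_eq ?_)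
  simp

/-- On any unit interval the `L²` norm of a weak derivative is controlled by its Gagliardo
seminorm and by the `L²` distance of the function to any constant. -/
theorem exists_lintegral_weakDeriv_sq_le {k : ℕ} (hk : 1 ≤ k) {s : ℝ} (hs : 0 < s) :
    ∃ B : ℝ, 0 < B ∧ ∀ v g : ℝ → ℝ, HasWeakDeriv k v g → Measurable g → ∀ τ b : ℝ,
      ∫⁻ x in Ico b (b + 1), ‖g x‖ₑ ^ 2 ≤ ENNReal.ofReal B *
        ((∫⁻ p in Ico b (b + 1) ×ˢ Ico b (b + 1), gagliardoDensity s g p) +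
          ∫⁻ x in Ico b (b + 1), ‖v x - τ‖ₑ ^ 2) := by
  obtain ⟨B, hB, H⟩ := exists_testFunction_unit_interval k
  refine ⟨2 * B ^ 2, by positivity, fun v g hvg hg τ b => ?_⟩
  obtain ⟨φ, hφ, hφc, hφ1, hφs, hφB, hφkB⟩ := H b
  have hts : tsupport φ ⊆ Ico b (b + 1) := hφs.trans Ioo_subset_Ico_self
  have hgφ : Integrable fun y => g y * φ y := by
    simpa only [smul_eq_mul, mul_comm] using
      hvg.locallyIntegrable_deriv.integrable_smul_left_of_hasCompactSupport hφ.continuous hφc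
  have hφi : Integrable φ := hφ.continuous.integrable_of_hasCompactSupport hφc
  set I := Ico b (b + 1) with hI
  set m := ∫ y, g y * φ y with hm
  have hmle : ‖m‖ₑ ^ 2 ≤ ENNReal.ofReal B ^ 2 * ∫⁻ x in I, ‖v x - τ‖ₑ ^ 2 := by
    have hφk := hφ.contDiff_iteratedDeriv k
    have hφkc := hφc.iteratedDeriv k
    have e1 : ‖m‖ₑ = ‖∫ x, v x * iteratedDeriv k φ x‖ₑ := by
      rw [hvg.integral_eq φ hφ hφc, enorm_mul]
      simp [hm, enorm_pow]
    -- Subtracting a constant is free because φ^(k) has zero integral, which needs k ≥ 1.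
    have e2 : ∫ x, v x * iteratedDeriv k φ x = ∫ x, (v x - τ) * iteratedDeriv k φ x := by
      have i1 : Integrable fun x => v x * iteratedDeriv k φ x := by
        simpa only [smul_eq_mul, mul_comm] using
          hvg.locallyIntegrable.integrable_smul_left_of_hasCompactSupport hφk.continuous hφkc
      have i2 : Integrable fun x => τ * iteratedDeriv k φ x :=
        (hφk.continuous.integrable_of_hasCompactSupport hφkc).const_mul τ
      simp_rw [sub_mul]
      rw [integral_sub i1 i2, integral_const_mul, integral_iteratedDeriv_eq_zero hφ hφc hk]
      simp
    rw [e1, e2]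
    exact enorm_integral_mul_sq_le
      (hvg.locallyIntegrable.aestronglyMeasurable.aemeasurable.sub_const τ)
      ((support_iteratedDeriv_subset_tsupport φ k).trans hts) hφkB
  have hx : ∀ x ∈ I, ‖g x‖ₑ ^ 2 ≤ 2 * (ENNReal.ofReal B ^ 2 *
      ∫⁻ y in I, gagliardoDensity s g (x, y)) + 2 * ‖m‖ₑ ^ 2 := by
    intro x hx
    have h := enorm_add_sq_le (g x - m) m
    rw [sub_add_cancel] at h
    refine h.trans ?_
    gcongr
    -- Since φ has integral 1, m is a weighted mean of g, and the deviation from it is controlled by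
    -- the seminorm on the cell.
    have e : g x - m = ∫ y, (g x - g y) * φ y := by
      simp_rw [sub_mul]
      rw [integral_sub (hφi.const_mul _) hgφ, integral_const_mul, hφ1, mul_one]
    rw [e]
    refine (enorm_integral_mul_sq_le (hg.const_sub _).aemeasurable
      ((subset_tsupport φ).trans hts) hφB).trans ?_
    gcongr ENNReal.ofReal B ^ 2 * ?_
    refine setLIntegral_mono' measurableSet_Ico fun y hy => ?_
    have hxy : |x - y| ≤ 1 := by
      rw [abs_le]; constructor <;> linarith [hx.1, hx.2, hy.1, hy.2]
    simpa using enorm_sub_sq_le_gagliardoDensity hs g hxy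
  refine (setLIntegral_mono' measurableSet_Ico hx).trans ?_
  have hk := measurable_gagliardoDensity s hg
  rw [lintegral_add_right _ measurable_const, lintegral_const_mul _ (by fun_prop),
    lintegral_const_mul _ (by fun_prop), lintegral_const, Measure.restrict_apply_univ,
    Measure.volume_eq_prod, ← Measure.prod_restrict, lintegral_prod _ hk.aemeasurable,
    ENNReal.ofReal_mul (by norm_num), ENNReal.ofReal_pow hB.le, ENNReal.ofReal_ofNat, hI,
    Real.volume_Ico, add_sub_cancel_left, ENNReal.ofReal_one, mul_one, ← hI]
  refine (add_le_add_right (mul_le_mul_right hmle 2) _).trans (le_of_eq ?_)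
  ring

/-- Each cell uses only its own diagonal square. These squares are disjoint, so summing costs the
full seminorm once and the constant does not depend on the number of cells. -/
theorem exists_setLIntegral_weakDeriv_sq_le {k : ℕ} (hk : 1 ≤ k) {s : ℝ} (hs : 0 < s) :
    ∃ B : ℝ, 0 < B ∧ ∀ v g : ℝ → ℝ, HasWeakDeriv k v g → Measurable g →
      ∀ (τ a : ℝ) (N : Set ℤ), ∫⁻ x in ⋃ n ∈ N, Ico (a + n) (a + n + 1), ‖g x‖ₑ ^ 2 ≤
        ENNReal.ofReal B * ((∫⁻ p, gagliardoDensity s g p) +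
          ∫⁻ x in ⋃ n ∈ N, Ico (a + n) (a + n + 1), ‖v x - τ‖ₑ ^ 2) := by
  obtain ⟨B, hB, H⟩ := exists_lintegral_weakDeriv_sq_le hk hs
  refine ⟨B, hB, fun v g hvg hg τ a N => ?_⟩
  have hd : N.PairwiseDisjoint fun n : ℤ => Ico (a + n) (a + n + 1) := fun i _ j _ hij =>
    pairwise_disjoint_Ico_add_intCast a hij
  have hd2 : N.PairwiseDisjoint fun n : ℤ =>
      Ico (a + n) (a + n + 1) ×ˢ Ico (a + n) (a + n + 1) := fun i hi j hj hij =>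
    (hd hi hj hij).set_prod_left _ _
  have hN := N.to_countable
  rw [lintegral_biUnion hN (fun _ _ => measurableSet_Ico) hd,
    lintegral_biUnion hN (fun _ _ => measurableSet_Ico) hd]
  have h2 : ∑' n : N, ∫⁻ p in Ico (a + (n : ℤ)) (a + (n : ℤ) + 1) ×ˢ
      Ico (a + (n : ℤ)) (a + (n : ℤ) + 1), gagliardoDensity s g p ≤
      ∫⁻ p, gagliardoDensity s g p := by
    rw [← lintegral_biUnion hN (fun _ _ => measurableSet_Ico.prod measurableSet_Ico) hd2]
    exact setLIntegral_le_lintegral _ _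
  refine (ENNReal.tsum_le_tsum fun n : N => H v g hvg hg τ (a + (n : ℤ))).trans ?_
  rw [ENNReal.tsum_mul_left, ENNReal.tsum_add]
  gcongr

theorem iUnion_Ico_nonneg_eq_Ici (c : ℝ) :
    ⋃ n ∈ {n : ℤ | 0 ≤ n}, Ico (c + n) (c + n + 1) = Ici c := by
  ext x
  simp only [mem_iUnion, mem_Ico, mem_Ici, exists_prop, mem_ofPred_eq]
  constructor
  · rintro ⟨n, hn, h1, -⟩
    have : (0 : ℝ) ≤ n := by exact_mod_cast hn
    linarith
  · intro hx
    refine ⟨⌊x - c⌋, Int.floor_nonneg.2 (by linarith), ?_, ?_⟩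
    · linarith [Int.floor_le (x - c)]
    · linarith [Int.lt_floor_add_one (x - c)]

theorem iUnion_Ico_neg_eq_Iio (c : ℝ) :
    ⋃ n ∈ {n : ℤ | n < 0}, Ico (c + n) (c + n + 1) = Iio c := by
  ext x
  simp only [mem_iUnion, mem_Ico, mem_Iio, exists_prop, mem_ofPred_eq]
  constructor
  · rintro ⟨n, hn, -, h1⟩
    have : (n : ℝ) + 1 ≤ 0 := by exact_mod_cast hn
    linarith
  · intro hx
    refine ⟨⌊x - c⌋, Int.floor_lt.2 (by simpa using hx), ?_, ?_⟩
    · linarith [Int.floor_le (x - c)]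
    · linarith [Int.lt_floor_add_one (x - c)]

/-! ### Local boundedness for s > 1/2, by a Campanato-type argument on averages. -/

theorem setAverage_sub_sq_mul_le {g : ℝ → ℝ} (hg : Measurable g) {A B : Set ℝ} (hA0 : volume A ≠ 0) (hA1 : volume A ≠ ⊤)
    (hB0 : volume B ≠ 0) (hB1 : volume B ≠ ⊤) (hgA : IntegrableOn g A) (hgB : IntegrableOn g B) :
    ‖(⨍ x in A, g x) - ⨍ y in B, g y‖ₑ ^ 2 * (volume A * volume B) ≤
      ∫⁻ p in A ×ˢ B, ‖g p.1 - g p.2‖ₑ ^ 2 := by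
  have : IsFiniteMeasure (volume.restrict A) := ⟨by simpa using hA1.lt_top⟩
  have : IsFiniteMeasure (volume.restrict B) := ⟨by simpa using hB1.lt_top⟩
  have hAr : volume.real A ≠ 0 := by
    simpa [Measure.real, ENNReal.toReal_eq_zero_iff, hA1] using hA0
  have hBr : volume.real B ≠ 0 := by
    simpa [Measure.real, ENNReal.toReal_eq_zero_iff, hB1] using hB0
  set D := (⨍ x in A, g x) - ⨍ y in B, g y with hD
  have e : D * (volume.real A * volume.real B) = ∫ p in A ×ˢ B, (g p.1 - g p.2) := by
    have i1 : Integrable (fun p : ℝ × ℝ => g p.1)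
        ((volume.restrict A).prod (volume.restrict B)) := hgA.comp_fst _
    have i2 : Integrable (fun p : ℝ × ℝ => g p.2)
        ((volume.restrict A).prod (volume.restrict B)) := hgB.comp_snd _
    rw [Measure.volume_eq_prod, ← Measure.prod_restrict, integral_sub i1 i2, integral_fun_fst,
      integral_fun_snd, hD, setAverage_eq, setAverage_eq]
    simp only [measureReal_restrict_apply_univ, smul_eq_mul]
    field_simp
  have h1 : ‖D‖ₑ * (volume A * volume B) ≤ ∫⁻ p in A ×ˢ B, ‖g p.1 - g p.2‖ₑ := by
    have h := enorm_integral_le_lintegral_enorm (μ := volume.restrict (A ×ˢ B))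
      (fun p : ℝ × ℝ => g p.1 - g p.2)
    rw [← e, enorm_mul, enorm_mul, Real.enorm_eq_ofReal measureReal_nonneg,
      Real.enorm_eq_ofReal measureReal_nonneg, ofReal_measureReal hA1, ofReal_measureReal hB1] at h
    exact h
  have hV : (volume.restrict (A ×ˢ B)) univ = volume A * volume B := by
    rw [Measure.restrict_apply_univ, Measure.volume_eq_prod, Measure.prod_prod]
  have h2 := (pow_le_pow_left' h1 2).trans (sq_lintegral_le (volume.restrict (A ×ˢ B))
    (by fun_prop : Measurable fun p : ℝ × ℝ => ‖g p.1 - g p.2‖ₑ).aemeasurable)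
  rw [hV] at h2
  have hV0 : volume A * volume B ≠ 0 := mul_ne_zero hA0 hB0
  refine (ENNReal.mul_le_mul_iff_right hV0 (ENNReal.mul_ne_top hA1 hB1)).1 (le_trans ?_ h2)
  rw [mul_pow]
  exact le_of_eq (by ring)

/-- Local boundedness of functions of finite Gagliardo seminorm of order `s > 1/2`. -/
theorem exists_ae_abs_le_of_gagliardo_lt_top {s : ℝ} (hs : 1 / 2 < s) {g : ℝ → ℝ}
    (hg : Measurable g) (hgl : LocallyIntegrable g) (R : ℝ)
    (hK : ∫⁻ p in Ioo (-(R + 1)) (R + 1) ×ˢ Ioo (-(R + 1)) (R + 1), gagliardoDensity s g p < ⊤) :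
    ∃ B : ℝ, ∀ᵐ x : ℝ, |x| < R → |g x| ≤ B := by
  set J := Ioo (-(R + 1)) (R + 1) with hJ
  set K := (∫⁻ p in J ×ˢ J, gagliardoDensity s g p).toReal with hKdef
  have hK0 : 0 ≤ K := ENNReal.toReal_nonneg
  have hgJ : IntegrableOn g J :=
    (hgl.integrableOn_isCompact isCompact_Icc).mono_set Ioo_subset_Icc_self
  -- Averages over concentric balls of radii r = 2^(-n) and r/2 differ in square by at most
  -- (2r)^(1+2s) K / (2r²) = C² q^(2n). The ratio q is below 1 because s > 1/2, so the averages
  -- converge geometrically, to g(x) at Lebesgue points.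
  set q : ℝ := (1 / 2 : ℝ) ^ (s - 1 / 2) with hq
  have hq0 : 0 < q := by positivity
  have hq1 : q < 1 := Real.rpow_lt_one (by norm_num) (by norm_num) (by linarith)
  set C : ℝ := √(2 ^ (2 * s) * K) with hC
  refine ⟨(∫ y in J, |g y|) / 2 + C / (1 - q), ?_⟩
  filter_upwards [IsUnifLocDoublingMeasure.ae_tendsto_average volume hgl 1] with x hx hxR
  rw [abs_lt] at hxR
  have hr0 : ∀ n : ℕ, (0 : ℝ) < (1 / 2) ^ n := fun n => by positivity
  have hr1 : ∀ n : ℕ, ((1 : ℝ) / 2) ^ n ≤ 1 := fun n => pow_le_one₀ (by norm_num) (by norm_num)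
  have hδ : Filter.Tendsto (fun n : ℕ => ((1 : ℝ) / 2) ^ n) Filter.atTop
      (nhdsWithin 0 (Ioi 0)) := by
    rw [tendsto_nhdsWithin_iff]
    exact ⟨tendsto_pow_atTop_nhds_zero_of_lt_one (by norm_num) (by norm_num),
      Filter.Eventually.of_forall hr0⟩
  have hlim := hx (fun _ => x) _ hδ (Filter.Eventually.of_forall fun n => by
    simp)
  set A : ℕ → ℝ := fun n => ⨍ y in Metric.closedBall x ((1 / 2) ^ n), g y with hA
  have hball : ∀ n : ℕ, Metric.closedBall x ((1 / 2) ^ n) ⊆ J := by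
    intro n y hy
    rw [Metric.mem_closedBall, Real.dist_eq, abs_le] at hy
    constructor <;> linarith [hr1 n, hy.1, hy.2]
  have hstep : ∀ n, dist (A n) (A (n + 1)) ≤ C * q ^ n := by
    intro n
    set r : ℝ := (1 / 2) ^ n with hr
    have hrpos : 0 < r := hr0 n
    have hr' : ((1 : ℝ) / 2) ^ (n + 1) = r / 2 := by rw [pow_succ]; ring
    have hb1 := hball n
    have hb2 := hball (n + 1)
    rw [hr'] at hb2
    have h := setAverage_sub_sq_mul_le hg (A := Metric.closedBall x r)
      (B := Metric.closedBall x (r / 2))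
      (by simpa using hrpos) measure_closedBall_lt_top.ne (by simpa using hrpos)
      measure_closedBall_lt_top.ne
      (hgJ.mono_set hb1) (hgJ.mono_set hb2)
    have h' : ∫⁻ p in Metric.closedBall x r ×ˢ Metric.closedBall x (r / 2),
        ‖g p.1 - g p.2‖ₑ ^ 2 ≤ ENNReal.ofReal ((2 * r) ^ (1 + 2 * s) * K) := by
      rw [ENNReal.ofReal_mul (by positivity), hKdef, ENNReal.ofReal_toReal hK.ne,
        ← lintegral_const_mul _ (measurable_gagliardoDensity s hg)]
      refine (setLIntegral_mono' (measurableSet_closedBall.prod measurableSet_closedBall)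
        fun p hp => ?_).trans (lintegral_mono_set (prod_mono hb1 hb2))
      refine enorm_sub_sq_le_gagliardoDensity (by linarith) g ?_
      have h1 := hp.1
      have h2 := hp.2
      rw [Metric.mem_closedBall, Real.dist_eq, abs_le] at h1 h2
      rw [abs_le]; constructor <;> linarith [h1.1, h1.2, h2.1, h2.2]
    have h3 := h.trans h'
    rw [Real.volume_closedBall, Real.volume_closedBall, ← ENNReal.ofReal_mul (by positivity),
      Real.enorm_eq_ofReal_abs, ← ENNReal.ofReal_pow (abs_nonneg _),
      ← ENNReal.ofReal_mul (by positivity), ENNReal.ofReal_le_ofReal_iff (by positivity)] at h3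
    have hq2 : (q ^ n) ^ 2 = r ^ (2 * s - 1) := by
      rw [hq, hr, ← Real.rpow_natCast, ← Real.rpow_natCast, ← Real.rpow_natCast,
        ← Real.rpow_mul (by positivity), ← Real.rpow_mul (by positivity),
        ← Real.rpow_mul (by positivity)]
      congr 1; push_cast; ring
    have h4 : |A n - A (n + 1)| ^ 2 ≤ (C * q ^ n) ^ 2 := by
      rw [mul_pow, hq2, hC, Real.sq_sqrt (by positivity)]
      have e1 : (2 * r) ^ (1 + 2 * s) = 2 * 2 ^ (2 * s) * (r ^ (2 * s - 1) * r ^ 2) := by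
        rw [Real.mul_rpow (by norm_num) hrpos.le, Real.rpow_add (by norm_num), Real.rpow_one,
          ← Real.rpow_natCast r 2, ← Real.rpow_add hrpos]
        congr 2; push_cast; ring
      rw [e1] at h3
      simp only [hA, hr']
      have : 0 < 2 * r ^ 2 := by positivity
      refine le_of_mul_le_mul_right (h3.trans_eq' ?_ |>.trans_eq ?_) this <;> ring
    rw [Real.dist_eq]
    exact (abs_le_of_sq_le_sq' (by simpa using h4) (by positivity)).2
  have hdist := dist_le_of_le_geometric_of_tendsto₀ q C hq1 hstep hlim
  have hA0 : |A 0| ≤ (∫ y in J, |g y|) / 2 := by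
    simp only [hA, pow_zero, setAverage_eq, smul_eq_mul, abs_mul]
    have h1 : |∫ y in Metric.closedBall x 1, g y| ≤ ∫ y in J, |g y| := by
      refine (abs_integral_le_integral_abs).trans (setIntegral_mono_set hgJ.abs
        (Filter.Eventually.of_forall fun y => abs_nonneg _) ?_)
      have := hball 0
      rw [pow_zero] at this
      exact this.eventuallyLE
    have h2 : volume.real (Metric.closedBall x 1) = 2 := by
      simp [Measure.real]
    rw [h2]
    norm_num
    linarith
  rw [Real.dist_eq, abs_sub_comm] at hdist
  have := abs_add_le (g x - A 0) (A 0)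
  rw [sub_add_cancel] at this
  linarith

/-! ### Weak derivatives: constancy, continuous representatives, locality. -/

/-- A locally integrable function with vanishing weak derivative is constant. -/
theorem exists_ae_eq_const_of_integral_mul_deriv_eq_zero {w : ℝ → ℝ} (hw : LocallyIntegrable w)
    (h : ∀ φ : ℝ → ℝ, ContDiff ℝ ∞ φ → HasCompactSupport φ → ∫ x, w x * deriv φ x = 0) :
    ∃ c : ℝ, ∀ᵐ x : ℝ, w x = c := by
  obtain ⟨_, _, H⟩ := exists_testFunction_unit_interval 0
  obtain ⟨χ, hχ, hχc, hχ1, -⟩ := H 0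
  refine ⟨∫ x, w x * χ x, ae_eq_of_integral_contDiff_smul_eq hw (locallyIntegrable_const _)
    fun ψ hψ hψc => ?_⟩
  have int : ∀ φ : ℝ → ℝ, ContDiff ℝ ∞ φ → HasCompactSupport φ →
      Integrable fun x => w x * φ x := fun φ h1 h2 => by
    simpa only [smul_eq_mul, mul_comm] using
      hw.integrable_smul_left_of_hasCompactSupport h1.continuous h2
  have iψ : Integrable ψ := hψ.continuous.integrable_of_hasCompactSupport hψc
  have iχ : Integrable χ := hχ.continuous.integrable_of_hasCompactSupport hχc
  set m := ∫ x, ψ x with hm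
  -- Removing the mean of ψ makes the primitive of θ compactly supported, hence an admissible test
  -- function whose derivative is θ.
  set θ : ℝ → ℝ := fun x => ψ x - m * χ x with hθ
  have hθd : ContDiff ℝ ∞ θ := by fun_prop
  have hθc : HasCompactSupport θ := hψc.sub (hχc.mul_left (f := fun _ => m))
  have iθ : Integrable θ := hθd.continuous.integrable_of_hasCompactSupport hθc
  have hθ0 : ∫ x, θ x = 0 := by
    rw [hθ, integral_sub iψ (iχ.const_mul m), integral_const_mul, hχ1, ← hm]; ring
  set Φ : ℝ → ℝ := fun x => ∫ t in Iic x, θ t with hΦ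
  have hΦd : ∀ x, HasDerivAt Φ (θ x) x := by
    intro x
    have e : Φ = fun x => (∫ t in Iic 0, θ t) + ∫ t in (0 : ℝ)..x, θ t := by
      funext x
      rw [← intervalIntegral.integral_Iic_sub_Iic iθ.integrableOn iθ.integrableOn]
      simp [hΦ]
    rw [e]
    exact (intervalIntegral.integral_hasDerivAt_right (hθd.continuous.intervalIntegrable _ _)
      hθd.continuous.stronglyMeasurable.stronglyMeasurableAtFilter
      hθd.continuous.continuousAt).const_add _
  have hΦ' : deriv Φ = θ := funext fun x => (hΦd x).deriv
  have hΦs : ContDiff ℝ ∞ Φ :=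
    contDiff_infty_iff_deriv.2 ⟨fun x => (hΦd x).differentiableAt, hΦ' ▸ hθd⟩
  obtain ⟨R, hR⟩ := hθc.isCompact.isBounded.subset_closedBall 0
  have hθR : ∀ t, R < |t| → θ t = 0 := fun t ht => by
    by_contra h0
    have := hR (subset_tsupport θ h0)
    rw [Metric.mem_closedBall, Real.dist_eq, sub_zero] at this
    linarith
  have hΦc : HasCompactSupport Φ := by
    refine HasCompactSupport.of_support_subset_isCompact (isCompact_closedBall (0 : ℝ) R)
      fun x hx => ?_
    by_contra hxR
    rw [Metric.mem_closedBall, Real.dist_eq, sub_zero, not_le] at hxR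
    apply hx
    rcases le_or_gt 0 x with h0 | h0
    · rw [abs_of_nonneg h0] at hxR
      rw [← hθ0, hΦ]
      refine setIntegral_eq_integral_of_forall_compl_eq_zero fun t ht => hθR t ?_
      rw [mem_Iic, not_le] at ht
      exact (hxR.trans ht).trans_le (le_abs_self t)
    · rw [abs_of_neg h0] at hxR
      refine setIntegral_eq_zero_of_forall_eq_zero fun t ht => hθR t ?_
      rw [mem_Iic] at ht
      rw [abs_of_neg (by linarith)]
      linarith
  have key := h Φ hΦs hΦc
  rw [hΦ'] at key
  have e : ∀ x, w x * θ x = w x * ψ x - m * (w x * χ x) := fun x => by simp only [hθ]; ring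
  simp_rw [e] at key
  rw [integral_sub (int ψ hψ hψc) ((int χ hχ hχc).const_mul m), integral_const_mul] at key
  simp only [smul_eq_mul]
  rw [integral_mul_const, ← hm]
  simp_rw [mul_comm (ψ _)]
  linarith

theorem HasWeakDeriv.intervalIntegrable {j : ℕ} {v g : ℝ → ℝ} (h : HasWeakDeriv j v g)
    (x y : ℝ) : IntervalIntegrable g volume x y :=
  (h.locallyIntegrable_deriv.integrableOn_isCompact isCompact_uIcc).intervalIntegrable

/-- A function with a first order weak derivative has a continuous representative. -/
theorem HasWeakDeriv.exists_continuous_ae_eq {v g : ℝ → ℝ} (h : HasWeakDeriv 1 v g) :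
    ∃ u : ℝ → ℝ, Continuous u ∧ v =ᵐ[volume] u := by
  -- The primitive F is absolutely continuous with F' = g almost everywhere. Integration by parts
  -- shows that v - F has zero weak derivative, so v = F + c almost everywhere.
  set F : ℝ → ℝ := fun x => ∫ t in (0 : ℝ)..x, g t with hF
  have hFc : Continuous F := intervalIntegral.continuous_primitive h.intervalIntegrable 0
  have hFd := LocallyIntegrable.ae_hasDerivAt_integral h.locallyIntegrable_deriv
  have parts : ∀ φ : ℝ → ℝ, ContDiff ℝ ∞ φ → HasCompactSupport φ →
      ∫ x, F x * deriv φ x = -∫ x, g x * φ x := by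
    intro φ hφ hφc
    obtain ⟨R, hR⟩ := hφc.isCompact.isBounded.subset_closedBall 0
    have hz : ∀ t, R < |t| → t ∉ tsupport φ := fun t ht h0 => by
      have := hR h0
      rw [Metric.mem_closedBall, Real.dist_eq, sub_zero] at this
      linarith
    set S := max R 0 + 1 with hS
    have hS0 : 0 < S := by positivity
    have hRS : R < S := (le_max_left R 0).trans_lt (lt_add_one _)
    have hout : ∀ t, t ∉ Ioc (-S) S → t ∉ tsupport φ := fun t ht => hz t <| by
      by_contra hlt
      rw [not_lt, abs_le] at hlt
      exact ht ⟨by linarith, by linarith⟩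
    have acF : AbsolutelyContinuousOnInterval F (-S) S :=
      (h.intervalIntegrable _ _).absolutelyContinuousOnInterval_intervalIntegral
        (by rw [uIcc_of_le (by linarith)]; exact ⟨by linarith, hS0.le⟩)
    have acφ : AbsolutelyContinuousOnInterval φ (-S) S :=
      ContDiffOn.absolutelyContinuousOnInterval (hφ.of_le (by simp)).contDiffOn
    have ibp := AbsolutelyContinuousOnInterval.integral_mul_deriv_eq_deriv_mul acF acφ
    have b1 : φ S = 0 := image_eq_zero_of_notMem_tsupport (hz _ (by rwa [abs_of_pos hS0]))
    have b2 : φ (-S) = 0 :=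
      image_eq_zero_of_notMem_tsupport (hz _ (by rwa [abs_neg, abs_of_pos hS0]))
    rw [b1, b2, intervalIntegral.integral_of_le (by linarith),
      intervalIntegral.integral_of_le (by linarith),
      setIntegral_eq_integral_of_forall_compl_eq_zero,
      setIntegral_eq_integral_of_forall_compl_eq_zero] at ibp
    · rw [ibp]
      simp only [mul_zero, sub_self, zero_sub, neg_inj]
      refine integral_congr_ae ?_
      filter_upwards [hFd] with x hx
      rw [(hx 0).deriv]
    · intro t ht
      rw [image_eq_zero_of_notMem_tsupport (hout t ht), mul_zero]
    · intro t ht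
      rw [image_eq_zero_of_notMem_tsupport fun h' => hout t ht (tsupport_deriv_subset h'),
        mul_zero]
  obtain ⟨c, hc⟩ := exists_ae_eq_const_of_integral_mul_deriv_eq_zero
    (w := fun x => v x - F x) (h.locallyIntegrable.sub hFc.locallyIntegrable) fun φ hφ hφc => by
      have hφ' : Continuous (deriv φ) := hφ.continuous_deriv (by simp)
      have i1 : Integrable fun x => v x * deriv φ x := by
        simpa only [smul_eq_mul, mul_comm] using
          h.locallyIntegrable.integrable_smul_left_of_hasCompactSupport hφ' hφc.deriv
      have i2 : Integrable fun x => F x * deriv φ x :=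
        (hFc.mul hφ').integrable_of_hasCompactSupport hφc.deriv.mul_left
      have e := h.integral_eq φ hφ hφc
      rw [iteratedDeriv_one] at e
      simp_rw [sub_mul]
      rw [integral_sub i1 i2, e, parts φ hφ hφc]
      ring
  refine ⟨fun x => F x + c, by fun_prop, ?_⟩
  filter_upwards [hc] with x hx
  linarith

/-- Weak derivatives of positive order vanish where the function is constant. -/
theorem HasWeakDeriv.ae_eq_zero_of_ae_eq_const {k : ℕ} (hk : 1 ≤ k) {v g : ℝ → ℝ}
    (h : HasWeakDeriv k v g) {U : Set ℝ} (hU : IsOpen U) {τ : ℝ} (hv : ∀ᵐ x, x ∈ U → v x = τ) :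
    ∀ᵐ x, x ∈ U → g x = 0 := by
  refine hU.ae_eq_zero_of_integral_contDiff_smul_eq_zero
    (h.locallyIntegrable_deriv.locallyIntegrableOn U) fun φ hφ hφc hφU => ?_
  have e := h.integral_eq φ hφ hφc
  have e2 : ∫ x, v x * iteratedDeriv k φ x = ∫ x, τ * iteratedDeriv k φ x := by
    refine integral_congr_ae ?_
    filter_upwards [hv] with x hx
    by_cases hxU : x ∈ U
    · rw [hx hxU]
    · rw [Function.notMem_support.1 fun h0 =>
        hxU (hφU (support_iteratedDeriv_subset_tsupport φ k h0)), mul_zero, mul_zero]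
  rw [e2, integral_const_mul, integral_iteratedDeriv_eq_zero hφ hφc hk, mul_zero] at e
  simp only [smul_eq_mul, mul_comm (φ _)]
  exact (mul_eq_zero.1 e.symm).resolve_left (pow_ne_zero k (by norm_num))

theorem HasWeakDeriv.congr_deriv {j : ℕ} {v g h : ℝ → ℝ} (hg : HasWeakDeriv j v g)
    (hgh : g =ᵐ[volume] h) : HasWeakDeriv j v h where
  locallyIntegrable := hg.locallyIntegrable
  locallyIntegrable_deriv := hg.locallyIntegrable_deriv.congr hgh
  integral_eq φ h1 h2 := by
    rw [hg.integral_eq φ h1 h2]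
    congr 1
    refine integral_congr_ae ?_
    filter_upwards [hgh] with x hx
    rw [hx]

/-- For k = 0 the chosen `weakDeriv` is only some representative; together with uniqueness this
identifies it with `v` almost everywhere. -/
theorem HasWeakDeriv.self_of_zero {v g : ℝ → ℝ} (h : HasWeakDeriv 0 v g) :
    HasWeakDeriv 0 v v where
  locallyIntegrable := h.locallyIntegrable
  locallyIntegrable_deriv := h.locallyIntegrable
  integral_eq φ _ _ := by simp

/-! ### Local finiteness, and reduction of the energy excess to a nonlocal tail. -/

theorem MemHLoc.exists_measurable_weakDeriv {k : ℕ} {s : ℝ} {v : ℝ → ℝ} (hv : MemHLoc k s v) :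
    ∃ g : ℝ → ℝ, Measurable g ∧ weakDeriv k v =ᵐ[volume] g ∧ HasWeakDeriv k v g := by
  have h := (hv.1 k le_rfl).1
  have hm := h.locallyIntegrable_deriv.aestronglyMeasurable.aemeasurable
  exact ⟨hm.mk _, hm.measurable_mk, hm.ae_eq_mk, h.congr_deriv hm.ae_eq_mk⟩

theorem MemHLoc.lintegral_sq_lt_top {k : ℕ} {s : ℝ} {v g : ℝ → ℝ} (hv : MemHLoc k s v)
    (hg : weakDeriv k v =ᵐ[volume] g) (R : ℝ) : ∫⁻ x in Ioo (-R) R, ‖g x‖ₑ ^ 2 < ⊤ := by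
  have h := ((hv.1 k le_rfl).2 R).ae_eq (ae_restrict_of_ae hg)
  have h2 := lintegral_rpow_enorm_lt_top_of_eLpNorm_lt_top (by norm_num) (by norm_num) h.2
  simpa using h2

theorem MemHLoc.lintegral_gagliardoDensity_lt_top {k : ℕ} {s : ℝ} {v g : ℝ → ℝ}
    (hv : MemHLoc k s v) (hg : weakDeriv k v =ᵐ[volume] g) (R : ℝ) :
    ∫⁻ p in Ioo (-R) R ×ˢ Ioo (-R) R, gagliardoDensity s g p < ⊤ := by
  have h := hv.2 R
  rw [lintegral_congr_ae (ae_restrict_of_ae (gagliardoDensity_congr s hg.symm))]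
  simpa only [gagliardo, gagliardoDensity, one_mul] using h

theorem MemHLoc.exists_ae_abs_le {k : ℕ} {s : ℝ} (hks : 1 / 2 < (k : ℝ) + s) {v : ℝ → ℝ}
    (hv : MemHLoc k s v) (R : ℝ) : ∃ B : ℝ, ∀ᵐ x : ℝ, |x| < R → |v x| ≤ B := by
  rcases Nat.eq_zero_or_pos k with rfl | hk
  · obtain ⟨g, hg, hvg, hw⟩ := hv.exists_measurable_weakDeriv
    have e : v =ᵐ[volume] g := hw.self_of_zero.ae_eq hw
    obtain ⟨B, hB⟩ := exists_ae_abs_le_of_gagliardo_lt_top (by simpa using hks) hg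
      hw.locallyIntegrable_deriv R (hv.lintegral_gagliardoDensity_lt_top hvg (R + 1))
    refine ⟨B, ?_⟩
    filter_upwards [hB, e] with x hx hxe
    rwa [hxe]
  · obtain ⟨u, hu, hvu⟩ := (hv.1 1 hk).1.exists_continuous_ae_eq
    obtain ⟨B, hB⟩ := (isCompact_Icc (a := -R) (b := R)).exists_bound_of_continuousOn
      hu.continuousOn
    refine ⟨B, ?_⟩
    filter_upwards [hvu] with x hx hxR
    rw [hx]
    exact hB x (abs_le.1 hxR.le)

theorem IsDoubleWell.eq_zero_of_abs_eq_one {W : ℝ → ℝ} {αW βW : ℝ} (hW : IsDoubleWell W αW βW)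
    {z : ℝ} (hz : |z| = 1) : W z = 0 := by
  have h1 := hW.lower z (by rw [hz]; norm_num)
  have h2 := hW.upper z (by rw [hz]; norm_num)
  rw [hz] at h1 h2
  norm_num at h1 h2
  exact le_antisymm h2 h1

theorem abs_sign_mul_eq_one {σ x c : ℝ} (hσ : σ = 1 ∨ σ = -1) (hc : 0 < c) (hx : c ≤ |x|) :
    |σ * Real.sign x| = 1 := by
  have hx0 : x ≠ 0 := abs_pos.1 (hc.trans_le hx)
  rcases hσ with rfl | rfl <;> rcases lt_or_gt_of_ne hx0 with h | h <;>
    simp [Real.sign_of_neg, Real.sign_of_pos, h]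

theorem IsHomogenizationKernel.pos_upper {a : ℝ → ℝ → ℝ} {αa βa : ℝ}
    (ha : IsHomogenizationKernel a αa βa) : 0 < βa := by
  obtain ⟨p, h1, h2⟩ := (ha.lower.and ha.upper).exists
  exact ha.pos_lower.trans_le (h1.trans h2)

/-- `W` has no growth bound at infinity, so its integral is finite only because `v` is essentially
bounded on bounded intervals; this is where k + s > 1/2 enters. -/
theorem rescaledEnergy_Ioo_lt_top {W : ℝ → ℝ} {a : ℝ → ℝ → ℝ} {αW βW αa βa : ℝ} {k : ℕ} {s : ℝ}
    (hW : IsDoubleWell W αW βW) (ha : IsHomogenizationKernel a αa βa)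
    (hks : 1 / 2 < (k : ℝ) + s) {v : ℝ → ℝ} (hv : MemHLoc k s v) (R : ℝ) :
    rescaledEnergy W a k s v (Ioo (-R) R) < ⊤ := by
  refine ENNReal.add_lt_top.2 ⟨?_, ?_⟩
  · obtain ⟨B, hB⟩ := hv.exists_ae_abs_le hks R
    obtain ⟨A, hA⟩ := (isCompact_Icc (a := -B) (b := B)).exists_bound_of_continuousOn
      hW.continuous.continuousOn
    refine (setLIntegral_mono_ae' (g := fun _ => ENNReal.ofReal A) measurableSet_Ioo ?_).trans_lt ?_
    · filter_upwards [hB] with x hx hxR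
      exact ENNReal.ofReal_le_ofReal ((le_abs_self _).trans
        (hA _ (abs_le.1 (hx (abs_lt.2 hxR)))))
    · simp only [lintegral_const, Measure.restrict_apply_univ, Real.volume_Ioo]
      exact ENNReal.mul_lt_top ENNReal.ofReal_lt_top ENNReal.ofReal_lt_top
  · exact (setLIntegral_weight_le ha s _ _).trans_lt (ENNReal.mul_lt_top ENNReal.ofReal_lt_top
      (hv.lintegral_gagliardoDensity_lt_top (Filter.EventuallyEq.refl _ _) R))

theorem rescaledEnergy_univ_le {W : ℝ → ℝ} {a : ℝ → ℝ → ℝ} {αW βW αa βa : ℝ} {k : ℕ} {s : ℝ}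
    (hW : IsDoubleWell W αW βW) (ha : IsHomogenizationKernel a αa βa) {v g : ℝ → ℝ}
    (hg : weakDeriv k v =ᵐ[volume] g) {σ c T : ℝ} (hσ : σ = 1 ∨ σ = -1) (hc : 0 < c)
    (hcT : c ≤ T) (h0 : ∀ᵐ x : ℝ, c ≤ |x| → v x = σ * Real.sign x) :
    rescaledEnergy W a k s v univ ≤ rescaledEnergy W a k s v (Ioo (-T) T) +
      ENNReal.ofReal βa * ∫⁻ p in (Ioo (-T) T ×ˢ Ioo (-T) T)ᶜ, gagliardoDensity s g p := by
  have hpot : ∫⁻ x in univ, ENNReal.ofReal (W (v x)) =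
      ∫⁻ x in Ioo (-T) T, ENNReal.ofReal (W (v x)) := by
    have hz : ∫⁻ x in (Ioo (-T) T)ᶜ, ENNReal.ofReal (W (v x)) = 0 := by
      rw [← nonpos_iff_eq_zero, ← lintegral_zero (μ := volume.restrict (Ioo (-T) T)ᶜ)]
      refine setLIntegral_mono_ae' measurableSet_Ioo.compl ?_
      filter_upwards [h0] with x hx hxT
      have hxc : c ≤ |x| := hcT.trans (not_lt.1 fun h => hxT (abs_lt.1 h))
      rw [hx hxc, hW.eq_zero_of_abs_eq_one (abs_sign_mul_eq_one hσ hc hxc)]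
      simp
    rw [Measure.restrict_univ, ← lintegral_add_compl _ (measurableSet_Ioo (a := -T) (b := T)), hz,
      add_zero]
  rw [rescaledEnergy, rescaledEnergy, hpot, add_assoc]
  gcongr
  rw [gagliardo, gagliardo, univ_prod_univ, Measure.restrict_univ,
    ← lintegral_add_compl _ ((measurableSet_Ioo (a := -T) (b := T)).prod measurableSet_Ioo)]
  gcongr
  refine (setLIntegral_weight_le ha s _ _).trans (le_of_eq ?_)
  rw [lintegral_congr_ae (ae_restrict_of_ae (gagliardoDensity_congr s hg))]

theorem lintegral_gagliardoDensity_le_rescaledEnergy {W : ℝ → ℝ} {a : ℝ → ℝ → ℝ} {αa βa : ℝ}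
    {k : ℕ} {s : ℝ} (ha : IsHomogenizationKernel a αa βa) {v g : ℝ → ℝ}
    (hg : weakDeriv k v =ᵐ[volume] g) :
    ∫⁻ p, gagliardoDensity s g p ≤ ENNReal.ofReal αa⁻¹ * rescaledEnergy W a k s v univ := by
  have h := le_setLIntegral_weight ha s (weakDeriv k v) univ
  rw [Measure.restrict_univ, lintegral_congr_ae (gagliardoDensity_congr s hg)] at h
  calc ∫⁻ p, gagliardoDensity s g p
      = ENNReal.ofReal αa⁻¹ * (ENNReal.ofReal αa * ∫⁻ p, gagliardoDensity s g p) := by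
        rw [← mul_assoc, ← ENNReal.ofReal_mul (inv_nonneg.2 ha.pos_lower.le),
          inv_mul_cancel₀ ha.pos_lower.ne', ENNReal.ofReal_one, one_mul]
    _ ≤ _ := by
        gcongr
        refine h.trans ?_
        rw [rescaledEnergy, gagliardo, univ_prod_univ, Measure.restrict_univ, Measure.restrict_univ]
        exact le_add_left le_rfl

/-! ### Sign rigidity beyond the transition region, and control by the potential. -/

theorem forall_of_ae_of_isOpen {P : ℝ → Prop} {U : Set ℝ} (hU : IsOpen U)
    (hP : IsClosed {x | P x}) (h : ∀ᵐ x : ℝ, x ∈ U → P x) : ∀ x ∈ U, P x := by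
  have h1 : IsOpen (U ∩ {x | P x}ᶜ) := hU.inter hP.isOpen_compl
  have h2 : volume (U ∩ {x | P x}ᶜ) = 0 := by
    rw [ae_iff] at h
    convert h using 2
    ext x; simp
  intro x hx
  by_contra hx'
  have := h1.eq_empty_of_measure_zero h2
  exact (this ▸ (⟨hx, hx'⟩ : x ∈ U ∩ {x | P x}ᶜ) : x ∈ (∅ : Set ℝ))

/-- A continuous function whose modulus stays away from `0` on a half-line keeps the sign of its
value near infinity. -/
theorem sub_sq_eq_of_continuous {u : ℝ → ℝ} (hu : Continuous u) {τ η b c : ℝ}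
    (hτ : τ = 1 ∨ τ = -1) (hη : η < 1) (h1 : ∀ᵐ x : ℝ, b ≤ x → u x = τ)
    (h2 : ∀ᵐ x : ℝ, c ≤ x → |(|u x| - 1)| ≤ η) {x : ℝ} (hx : c < x) :
    (u x - τ) ^ 2 = (1 - |u x|) ^ 2 := by
  have k1 : ∀ x ∈ Ioi b, u x = τ := forall_of_ae_of_isOpen isOpen_Ioi
    (isClosed_eq hu continuous_const) (by filter_upwards [h1] with x hx hx' using hx (le_of_lt hx'))
  have k2 : ∀ x ∈ Ioi c, |(|u x| - 1)| ≤ η := forall_of_ae_of_isOpen isOpen_Ioi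
    (isClosed_le (by fun_prop) continuous_const)
    (by filter_upwards [h2] with x hx hx' using hx (le_of_lt hx'))
  have hne : ∀ y ∈ Ioi c, u y ≠ 0 := fun y hy h0 => by
    have := k2 y hy
    rw [h0] at this
    norm_num at this
    linarith
  set y := max x b + 1 with hy
  have hyb : u y = τ := k1 y (by
    have := le_max_right x b
    simp only [mem_Ioi]; linarith)
  have hyx : x ≤ y := by
    have := le_max_left x b
    linarith
  have hIcc : Icc x y ⊆ Ioi c := fun z hz => hx.trans_le hz.1
  have hpre := isPreconnected_Icc.image u (hu.continuousOn (s := Icc x y))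
  have hx0 := hne x hx
  -- The image of [x, y] is connected, avoids 0 and contains τ, so u(x) has the sign of τ.
  have h0 : (0 : ℝ) ∉ u '' Icc x y := by
    rintro ⟨z, hz, hz0⟩
    exact hne z (hIcc hz) hz0
  have mx : u x ∈ u '' Icc x y := mem_image_of_mem _ (left_mem_Icc.2 hyx)
  have my : τ ∈ u '' Icc x y := hyb ▸ mem_image_of_mem _ (right_mem_Icc.2 hyx)
  rcases hτ with rfl | rfl
  · have : 0 < u x := by
      by_contra hneg
      exact h0 (hpre.Icc_subset mx my ⟨not_lt.1 hneg, by norm_num⟩)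
    rw [abs_of_pos this]; ring
  · have : u x < 0 := by
      by_contra hneg
      exact h0 (hpre.Icc_subset my mx ⟨by norm_num, not_lt.1 hneg⟩)
    rw [abs_of_neg this]; ring

/-- The left half-line is the right one for x ↦ u(-x), whose value at infinity is -σ. -/
theorem ae_sub_sq_eq {v u : ℝ → ℝ} (hu : Continuous u) (hvu : v =ᵐ[volume] u)
    {σ η b c : ℝ} (hσ : σ = 1 ∨ σ = -1) (hη : η < 1) (hb : 0 < b)
    (h1 : ∀ᵐ x : ℝ, b ≤ |x| → v x = σ * Real.sign x)
    (h2 : ∀ᵐ x : ℝ, c ≤ |x| → |(|v x| - 1)| ≤ η) :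
    (∀ᵐ x : ℝ, c ≤ x → (v x - σ) ^ 2 = (1 - |v x|) ^ 2) ∧
      ∀ᵐ x : ℝ, x ≤ -c → (v x - -σ) ^ 2 = (1 - |v x|) ^ 2 := by
  have hneg : Measure.QuasiMeasurePreserving (Neg.neg : ℝ → ℝ) volume volume :=
    (Measure.measurePreserving_neg (volume : Measure ℝ)).quasiMeasurePreserving
  constructor
  · filter_upwards [hvu, Measure.ae_ne volume c] with x hx hxc hcx
    rw [hx]
    refine sub_sq_eq_of_continuous (b := b) (η := η) hu hσ hη ?_ ?_ (lt_of_le_of_ne hcx hxc.symm)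
    · filter_upwards [h1, hvu] with y hy hy' hby
      rw [← hy', hy (hby.trans (le_abs_self y)), Real.sign_of_pos (hb.trans_le hby), mul_one]
    · filter_upwards [h2, hvu] with y hy hy' hcy
      rw [← hy']
      exact hy (hcy.trans (le_abs_self y))
  · filter_upwards [hvu, Measure.ae_ne volume (-c)] with x hx hxc hcx
    rw [hx]
    have hσ' : -σ = 1 ∨ -σ = -1 := by rcases hσ with rfl | rfl <;> simp
    have := sub_sq_eq_of_continuous (u := fun x => u (-x)) (b := b) (c := c) (η := η) (τ := -σ)
      (x := -x) (by fun_prop) hσ' hη ?_ ?_ (by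
        have := lt_of_le_of_ne hcx hxc
        linarith)
    · simpa using this
    · filter_upwards [hneg.ae h1, hneg.ae hvu] with y hy hy' hby
      rw [← hy', hy (by rw [abs_neg]; exact hby.trans (le_abs_self y)),
        Real.sign_of_neg (by linarith)]
      ring
    · filter_upwards [hneg.ae h2, hneg.ae hvu] with y hy hy' hcy
      rw [← hy']
      exact hy (by rw [abs_neg]; exact hcy.trans (le_abs_self y))

theorem enorm_sq_eq_ofReal (x : ℝ) : ‖x‖ₑ ^ 2 = ENNReal.ofReal (x ^ 2) := by
  rw [Real.enorm_eq_ofReal_abs, ← ENNReal.ofReal_pow (abs_nonneg _), sq_abs]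

theorem IsDoubleWell.setLIntegral_sub_sq_le {W : ℝ → ℝ} {αW βW : ℝ} (hW : IsDoubleWell W αW βW)
    {v : ℝ → ℝ} {S : Set ℝ} (hS : MeasurableSet S) {τ : ℝ} (h2 : ∀ᵐ x : ℝ, x ∈ S → |v x| ≤ 2)
    (h : ∀ᵐ x : ℝ, x ∈ S → (v x - τ) ^ 2 = (1 - |v x|) ^ 2) :
    ∫⁻ x in S, ‖v x - τ‖ₑ ^ 2 ≤ ENNReal.ofReal αW⁻¹ * ∫⁻ x, ENNReal.ofReal (W (v x)) := by
  rw [← lintegral_const_mul' _ _ ENNReal.ofReal_ne_top]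
  refine (setLIntegral_mono_ae' hS ?_).trans (setLIntegral_le_lintegral S _)
  filter_upwards [h2, h] with x hx2 hx hxS
  rw [enorm_sq_eq_ofReal, hx hxS, ← ENNReal.ofReal_mul (inv_nonneg.2 hW.pos_lower.le)]
  refine ENNReal.ofReal_le_ofReal ?_
  rw [inv_mul_eq_div, le_div_iff₀ hW.pos_lower, mul_comm]
  exact hW.lower _ (hx2 hxS)

theorem toReal_sub_toReal_le {x y : ℝ≥0∞} {z : ℝ} (hy : y < ⊤) (hz : 0 ≤ z)
    (h : x ≤ y + ENNReal.ofReal z) : x.toReal - y.toReal ≤ z := by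
  have := ENNReal.toReal_mono (ENNReal.add_ne_top.2 ⟨hy.ne, ENNReal.ofReal_ne_top⟩) h
  rw [ENNReal.toReal_add hy.ne ENNReal.ofReal_ne_top, ENNReal.toReal_ofReal hz] at this
  linarith

theorem setLIntegral_Ioo_split_le (f : ℝ → ℝ≥0∞) {b c : ℝ} :
    ∫⁻ x in Ioo (-c) c, f x ≤
      (∫⁻ x in Ioo (-b) b, f x) + ((∫⁻ x in Ici b, f x) + ∫⁻ x in Iic (-b), f x) := by
  refine (lintegral_mono_set ?_).trans ((lintegral_union_le _ (Ioo (-b) b)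
    (Ici b ∪ Iic (-b))).trans (add_le_add_right (lintegral_union_le _ _ _) _))
  intro x _
  by_cases h1 : b ≤ x
  · exact Or.inr (Or.inl h1)
  · by_cases h2 : x ≤ -b
    · exact Or.inr (Or.inr h2)
    · exact Or.inl ⟨not_le.1 h2, not_le.1 h1⟩

theorem ae_abs_le_two {v : ℝ → ℝ} {η c : ℝ} (hη : η < 1)
    (h : ∀ᵐ x : ℝ, c ≤ |x| → |(|v x| - 1)| ≤ η) : ∀ᵐ x : ℝ, c ≤ |x| → |v x| ≤ 2 := by
  filter_upwards [h] with x hx hxc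
  linarith [(abs_le.1 (hx hxc)).2]

/-! ### L² bounds on the transition region in terms of the energy. -/

/-- For `k ≥ 1` the `L²` norm of `v^(k)` grows at most like the transition length. -/
theorem exists_lintegral_weakDeriv_sq_le_rescaledEnergy {k : ℕ} (hk : 1 ≤ k) {s αW αa : ℝ}
    (hs : 0 < s) (hαW : 0 < αW) (hαa : 0 < αa) :
    ∃ A : ℝ, 0 < A ∧ ∀ (W : ℝ → ℝ) (βW : ℝ), IsDoubleWell W αW βW → ∀ (a : ℝ → ℝ → ℝ) (βa : ℝ),
      IsHomogenizationKernel a αa βa → ∀ v g : ℝ → ℝ, MemHLoc k s v → Measurable g →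
      weakDeriv k v =ᵐ[volume] g → ∀ σ η b c : ℝ, σ = 1 ∨ σ = -1 → η < 1 → 1 < b → b < c →
      (∀ᵐ x : ℝ, c ≤ |x| → v x = σ * Real.sign x) →
      (∀ᵐ x : ℝ, b ≤ |x| → |(|v x| - 1)| ≤ η) →
      ∫⁻ x in Ioo (-c) c, ‖g x‖ₑ ^ 2 ≤
        ENNReal.ofReal (A * b ^ (2 * s)) * rescaledEnergy W a k s v univ := by
  obtain ⟨B, hB, H⟩ := exists_setLIntegral_weakDeriv_sq_le hk hs
  -- The factor 6 is 4 + 1 + 1: the (b, 2b) term of the Poincaré inequality and the two half-lines.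
  -- These terms carry no power of b and are absorbed using b^(2s) ≥ 1.
  refine ⟨2 * 3 ^ (1 + 2 * s) * αa⁻¹ + 6 * (B * (αa⁻¹ + αW⁻¹)), by positivity, ?_⟩
  intro W βW hW a βa ha v g hv hgm hg σ η b c hσ hη hb hbc h1 h2
  have hb0 : 0 < b := by linarith
  have hvg : HasWeakDeriv k v g := (hv.1 k le_rfl).1.congr_deriv hg
  set X := rescaledEnergy W a k s v univ with hX
  have hD : ∫⁻ p, gagliardoDensity s g p ≤ ENNReal.ofReal αa⁻¹ * X :=
    lintegral_gagliardoDensity_le_rescaledEnergy ha hg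
  have hP : ∫⁻ x, ENNReal.ofReal (W (v x)) ≤ X := by
    rw [hX, rescaledEnergy, Measure.restrict_univ]
    exact le_add_right le_rfl
  obtain ⟨u, hu, hvu⟩ := (hv.1 1 hk).1.exists_continuous_ae_eq
  obtain ⟨q1, q2⟩ := ae_sub_sq_eq hu hvu hσ hη (by linarith : 0 < c) h1 h2
  have h3 := ae_abs_le_two hη h2
  have half : ∀ (S : Set ℝ) (τ d : ℝ) (N : Set ℤ), MeasurableSet S →
      ⋃ n ∈ N, Ico (d + n) (d + n + 1) = S → (∀ᵐ x : ℝ, x ∈ S → |v x| ≤ 2) →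
      (∀ᵐ x : ℝ, x ∈ S → (v x - τ) ^ 2 = (1 - |v x|) ^ 2) →
      ∫⁻ x in S, ‖g x‖ₑ ^ 2 ≤ ENNReal.ofReal (B * (αa⁻¹ + αW⁻¹)) * X := by
    intro S τ d N hS hN hS2 hSq
    have e := H v g hvg hgm τ d N
    rw [hN] at e
    refine e.trans ?_
    rw [ENNReal.ofReal_mul hB.le, ENNReal.ofReal_add (by positivity) (by positivity), mul_assoc,
      add_mul]
    gcongr
    exact (hW.setLIntegral_sub_sq_le hS hS2 hSq).trans (by gcongr)
  have hR := half (Ici b) σ b {n : ℤ | 0 ≤ n} measurableSet_Ici (iUnion_Ico_nonneg_eq_Ici b)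
    (by filter_upwards [h3] with x hx hxb using hx ((mem_Ici.1 hxb).trans (le_abs_self x))) q1
  have hL := half (Iio (-b)) (-σ) (-b) {n : ℤ | n < 0} measurableSet_Iio
    (iUnion_Ico_neg_eq_Iio (-b))
    (by
      filter_upwards [h3] with x hx hxb
      refine hx ?_
      rw [mem_Iio] at hxb
      linarith [neg_le_abs x])
    (by filter_upwards [q2] with x hx hxb using hx (le_of_lt hxb))
  have hP2 := lintegral_sq_le_poincare hs hb0 hgm
  have hsub : ∫⁻ y in Ioo b (2 * b), ‖g y‖ₑ ^ 2 ≤ ∫⁻ y in Ici b, ‖g y‖ₑ ^ 2 :=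
    lintegral_mono_set (Ioo_subset_Ioi_self.trans Ioi_subset_Ici_self)
  have hb1 : 1 ≤ b ^ (2 * s) := Real.one_le_rpow hb.le (by linarith)
  calc ∫⁻ x in Ioo (-c) c, ‖g x‖ₑ ^ 2
      ≤ (∫⁻ x in Ioo (-b) b, ‖g x‖ₑ ^ 2) + ((∫⁻ x in Ici b, ‖g x‖ₑ ^ 2) +
          ∫⁻ x in Iio (-b), ‖g x‖ₑ ^ 2) := by
        rw [setLIntegral_congr (Iio_ae_eq_Iic (a := -b))]
        exact setLIntegral_Ioo_split_le _
    _ ≤ (ENNReal.ofReal (2 * 3 ^ (1 + 2 * s) * b ^ (2 * s)) * (ENNReal.ofReal αa⁻¹ * X) +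
          4 * (ENNReal.ofReal (B * (αa⁻¹ + αW⁻¹)) * X)) +
          ((ENNReal.ofReal (B * (αa⁻¹ + αW⁻¹)) * X) +
          (ENNReal.ofReal (B * (αa⁻¹ + αW⁻¹)) * X)) := by
        gcongr
        refine hP2.trans ?_
        gcongr
        exact hsub.trans hR
    _ = ENNReal.ofReal (2 * 3 ^ (1 + 2 * s) * b ^ (2 * s) * αa⁻¹ +
          6 * (B * (αa⁻¹ + αW⁻¹))) * X := by
        rw [ENNReal.ofReal_add (by positivity) (by positivity),
          ENNReal.ofReal_mul (p := 2 * 3 ^ (1 + 2 * s) * b ^ (2 * s)) (by positivity),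
          ENNReal.ofReal_mul (p := 6) (by norm_num), ENNReal.ofReal_ofNat]
        ring
    _ ≤ _ := by
        gcongr
        have : 0 < 6 * (B * (αa⁻¹ + αW⁻¹)) := by positivity
        nlinarith

/-- For `k = 0` the `L²` norm of `v` on the transition region, in terms of the energy. -/
theorem lintegral_sq_add_one_le_rescaledEnergy {W : ℝ → ℝ} {a : ℝ → ℝ → ℝ} {αa βa s : ℝ}
    (hs : 1 / 2 < s) (ha : IsHomogenizationKernel a αa βa) {v g : ℝ → ℝ} (hgm : Measurable g)
    (hg : weakDeriv 0 v =ᵐ[volume] g) (hvg : v =ᵐ[volume] g) {η b c : ℝ} (hη : η < 1)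
    (hb : 1 < b) (hbc : b < c) (h2 : ∀ᵐ x : ℝ, b ≤ |x| → |(|v x| - 1)| ≤ η) :
    ∫⁻ x in Ioo (-c) c, ENNReal.ofReal (2 * (g x ^ 2 + 1)) ≤
      ENNReal.ofReal (4 * 3 ^ (1 + 2 * s) * αa⁻¹ * c ^ (2 * s)) * rescaledEnergy W a 0 s v univ +
        ENNReal.ofReal (52 * c ^ (2 * s)) := by
  have hαa := ha.pos_lower
  have hb0 : 0 < b := by linarith
  have hc0 : 0 < c := by linarith
  -- Terms linear in c are absorbed into c^(2s), since c > 1 and 2s > 1.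
  have hcc : c ≤ c ^ (2 * s) := by
    conv_lhs => rw [← Real.rpow_one c]
    exact Real.rpow_le_rpow_of_exponent_le (by linarith) (by linarith)
  have hbcs : b ^ (2 * s) ≤ c ^ (2 * s) := Real.rpow_le_rpow hb0.le hbc.le (by linarith)
  set X := rescaledEnergy W a 0 s v univ with hX
  have hD : ∫⁻ p, gagliardoDensity s g p ≤ ENNReal.ofReal αa⁻¹ * X :=
    lintegral_gagliardoDensity_le_rescaledEnergy ha hg
  have h4 : ∀ᵐ x : ℝ, b ≤ |x| → ‖g x‖ₑ ^ 2 ≤ 4 := by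
    filter_upwards [ae_abs_le_two hη h2, hvg] with x hx hxe hxb
    rw [← hxe, Real.enorm_eq_ofReal_abs, ← ENNReal.ofReal_pow (abs_nonneg _),
      ← ENNReal.ofReal_ofNat]
    exact ENNReal.ofReal_le_ofReal (by nlinarith [hx hxb, abs_nonneg (v x)])
  have hN : ∫⁻ y in Ioo b (2 * b), ‖g y‖ₑ ^ 2 ≤ ENNReal.ofReal (4 * b) := by
    refine (setLIntegral_mono_ae' (g := fun _ => 4) measurableSet_Ioo ?_).trans (le_of_eq ?_)
    · filter_upwards [h4] with x hx hxb using hx (hxb.1.le.trans (le_abs_self x))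
    · rw [lintegral_const, Measure.restrict_apply_univ, Real.volume_Ioo,
        ENNReal.ofReal_mul (by norm_num), ENNReal.ofReal_ofNat]
      congr 2; ring
  have hin : ∫⁻ x in Ioo (-b) b, ‖g x‖ₑ ^ 2 ≤
      ENNReal.ofReal (2 * 3 ^ (1 + 2 * s) * c ^ (2 * s)) * (ENNReal.ofReal αa⁻¹ * X) +
        ENNReal.ofReal (16 * c) := by
    refine (lintegral_sq_le_poincare (by linarith : 0 < s) hb0 hgm).trans ?_
    have e : ENNReal.ofReal (16 * c) = 4 * ENNReal.ofReal (4 * c) := by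
      rw [show 16 * c = 4 * (4 * c) by ring, ENNReal.ofReal_mul (by norm_num),
        ENNReal.ofReal_ofNat]
    rw [e]
    gcongr
    exact hN.trans (by gcongr)
  have hall : ∫⁻ x in Ioo (-c) c, ‖g x‖ₑ ^ 2 ≤
      ENNReal.ofReal (2 * 3 ^ (1 + 2 * s) * c ^ (2 * s)) * (ENNReal.ofReal αa⁻¹ * X) +
        ENNReal.ofReal (24 * c) := by
    have hout : ∫⁻ x in Ioo (-c) c ∩ {x | b ≤ |x|}, ‖g x‖ₑ ^ 2 ≤ ENNReal.ofReal (8 * c) := by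
      refine (setLIntegral_mono_ae' (g := fun _ => 4)
        (measurableSet_Ioo.inter (measurableSet_le_abs b)) ?_).trans
        ((lintegral_mono_set inter_subset_left).trans (le_of_eq ?_))
      · filter_upwards [h4] with x hx hxb using hx hxb.2
      · rw [lintegral_const, Measure.restrict_apply_univ, Real.volume_Ioo,
          show 8 * c = 4 * (c - -c) by ring, ENNReal.ofReal_mul (p := 4) (by norm_num),
          ENNReal.ofReal_ofNat]
    have hsub : Ioo (-c) c ⊆ Ioo (-b) b ∪ Ioo (-c) c ∩ {x | b ≤ |x|} := fun x hx => by
      rcases lt_or_ge (|x|) b with h | h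
      · exact Or.inl (abs_lt.1 h)
      · exact Or.inr ⟨hx, h⟩
    refine (lintegral_mono_set hsub).trans ((lintegral_union_le _ _ _).trans
      ((add_le_add hin hout).trans (le_of_eq ?_)))
    rw [add_assoc, ← ENNReal.ofReal_add (by positivity) (by positivity)]
    congr 2; ring
  have e : ∀ x, ENNReal.ofReal (2 * (g x ^ 2 + 1)) = 2 * ‖g x‖ₑ ^ 2 + 2 := fun x => by
    rw [enorm_sq_eq_ofReal, mul_add, ENNReal.ofReal_add (by positivity) (by norm_num),
      ENNReal.ofReal_mul (by norm_num)]
    simp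
  simp_rw [e]
  rw [lintegral_add_right _ measurable_const, lintegral_const_mul _ (by fun_prop), lintegral_const,
    Measure.restrict_apply_univ, Real.volume_Ioo]
  calc 2 * (∫⁻ x in Ioo (-c) c, ‖g x‖ₑ ^ 2) + 2 * ENNReal.ofReal (c - -c)
      ≤ 2 * (ENNReal.ofReal (2 * 3 ^ (1 + 2 * s) * c ^ (2 * s)) * (ENNReal.ofReal αa⁻¹ * X) +
        ENNReal.ofReal (24 * c)) + 2 * ENNReal.ofReal (c - -c) := by gcongr
    -- Here 52 = 2·24 + 2·2, with 24 = 16 + 8: the Poincaré term on (b, 2b), and |g|² ≤ 4 on the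
    -- outer part of (-c, c).
    _ = ENNReal.ofReal (4 * 3 ^ (1 + 2 * s) * αa⁻¹ * c ^ (2 * s)) * X +
        ENNReal.ofReal (52 * c) := by
        rw [show 4 * 3 ^ (1 + 2 * s) * αa⁻¹ * c ^ (2 * s) =
            2 * ((2 * 3 ^ (1 + 2 * s) * c ^ (2 * s)) * αa⁻¹) by ring,
          show 52 * c = 2 * (24 * c) + 2 * (c - -c) by ring,
          ENNReal.ofReal_mul (p := 2) (by norm_num),
          ENNReal.ofReal_mul (p := 2 * 3 ^ (1 + 2 * s) * c ^ (2 * s)) (by positivity),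
          ENNReal.ofReal_add (by positivity) (by linarith),
          ENNReal.ofReal_mul (p := 2) (by norm_num), ENNReal.ofReal_mul (p := 2) (by norm_num),
          ENNReal.ofReal_ofNat]
        ring
    _ ≤ _ := by gcongr

/-! ### The tail estimates for k ≥ 1 and for k = 0. -/

theorem vanishing_tails_of_pos {k : ℕ} (hk : 1 ≤ k) {s : ℝ} (hs : 0 < s)
    {αW βW αa βa : ℝ} (hαW : 0 < αW) (hαa : 0 < αa) (M : ℝ) :
    ∃ C : ℝ, 0 < C ∧ ∀ W : ℝ → ℝ, IsDoubleWell W αW βW → ∀ a : ℝ → ℝ → ℝ,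
      IsHomogenizationKernel a αa βa → ∀ v : ℝ → ℝ, MemHLoc k s v → ∀ σ η b c : ℝ,
      σ = 1 ∨ σ = -1 → η < 1 → 1 < b → b < c →
      (∀ᵐ x : ℝ, c ≤ |x| → v x = σ * Real.sign x) →
      (∀ᵐ x : ℝ, b ≤ |x| → |(|v x| - 1)| ≤ η) →
      rescaledEnergy W a k s v univ < ⊤ ∧
      ((rescaledEnergy W a k s v univ).toReal ≤ M → ∀ T : ℝ, c < T →
        (rescaledEnergy W a k s v univ).toReal - (rescaledEnergy W a k s v (Ioo (-T) T)).toReal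
          ≤ C * (b / (T - c)) ^ (2 * s)) := by
  obtain ⟨A, hA, H⟩ := exists_lintegral_weakDeriv_sq_le_rescaledEnergy hk hs hαW hαa
  have hk1 : (1 : ℝ) ≤ k := by exact_mod_cast hk
  -- The constant is fixed before any kernel is given, so βa and M appear in absolute value; the
  -- added 1 keeps it positive even when M = 0.
  refine ⟨2 * |βa| * A * |M| / s + 1, by positivity, ?_⟩
  intro W hW a ha v hv σ η b c hσ hη hb hbc h1 h2
  obtain ⟨g, hgm, hg, hvg⟩ := hv.exists_measurable_weakDeriv
  have hc0 : 0 < c := by linarith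
  have hβa := ha.pos_upper
  have hg0 : ∀ᵐ x : ℝ, c ≤ |x| → g x = 0 := by
    have hp := hvg.ae_eq_zero_of_ae_eq_const hk (U := Ioi c) (τ := σ) isOpen_Ioi (by
      filter_upwards [h1] with x hx hxc
      rw [hx ((le_of_lt hxc).trans (le_abs_self x)), Real.sign_of_pos (hc0.trans hxc), mul_one])
    have hn := hvg.ae_eq_zero_of_ae_eq_const hk (U := Iio (-c)) (τ := -σ) isOpen_Iio (by
      filter_upwards [h1] with x hx hxc
      rw [mem_Iio] at hxc
      rw [hx (by linarith [neg_le_abs x]), Real.sign_of_neg (by linarith)]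
      ring)
    filter_upwards [hp, hn, Measure.ae_ne volume c, Measure.ae_ne volume (-c)]
      with x hxp hxn hxc hxc' hx
    rcases le_abs.1 hx with h | h
    · exact hxp (lt_of_le_of_ne h hxc.symm)
    · exact hxn (lt_of_le_of_ne (by linarith) hxc')
  have main : ∀ T, c < T → rescaledEnergy W a k s v univ ≤
      rescaledEnergy W a k s v (Ioo (-T) T) + ENNReal.ofReal βa *
        (2 * (ENNReal.ofReal ((T - c) ^ (-(2 * s)) / s) * ∫⁻ x in Ioo (-c) c, ‖g x‖ₑ ^ 2)) := by
    intro T hT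
    refine (rescaledEnergy_univ_le hW ha hg hσ hc0 hT.le h1).trans ?_
    gcongr
    simp_rw [enorm_sq_eq_ofReal]
    exact tail_le_of_eq_zero hs hT hgm hg0
  -- One admissible T suffices. Only the qualitative finiteness of ∫ g² is used, since the
  -- quantitative bound already involves the total energy.
  have hfin : rescaledEnergy W a k s v univ < ⊤ :=
    (main (c + 1) (by linarith)).trans_lt (ENNReal.add_lt_top.2
      ⟨rescaledEnergy_Ioo_lt_top hW ha (by linarith) hv _,
        ENNReal.mul_lt_top ENNReal.ofReal_lt_top (ENNReal.mul_lt_top (by simp)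
          (ENNReal.mul_lt_top ENNReal.ofReal_lt_top (hv.lintegral_sq_lt_top hg c)))⟩)
  refine ⟨hfin, fun hM T hT => ?_⟩
  have hTc : 0 < T - c := by linarith
  have hb0 : 0 < b := by linarith
  have hX : rescaledEnergy W a k s v univ ≤ ENNReal.ofReal |M| := by
    rw [← ENNReal.ofReal_toReal hfin.ne]
    exact ENNReal.ofReal_le_ofReal (hM.trans (le_abs_self M))
  have hL := (H W βW hW a βa ha v g hv hgm hg σ η b c hσ hη hb hbc h1 h2).trans
    (mul_le_mul_right hX _)
  have hfinal : rescaledEnergy W a k s v univ ≤ rescaledEnergy W a k s v (Ioo (-T) T) +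
      ENNReal.ofReal (2 * |βa| * A * |M| / s * (b / (T - c)) ^ (2 * s)) := by
    refine (main T hT).trans ?_
    gcongr
    calc ENNReal.ofReal βa * (2 * (ENNReal.ofReal ((T - c) ^ (-(2 * s)) / s) *
          ∫⁻ x in Ioo (-c) c, ‖g x‖ₑ ^ 2))
        ≤ ENNReal.ofReal βa * (2 * (ENNReal.ofReal ((T - c) ^ (-(2 * s)) / s) *
          (ENNReal.ofReal (A * b ^ (2 * s)) * ENNReal.ofReal |M|))) := by gcongr
      _ = _ := by
        rw [← ENNReal.ofReal_mul (by positivity), ← ENNReal.ofReal_mul (by positivity),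
          ← ENNReal.ofReal_ofNat, ← ENNReal.ofReal_mul (by norm_num),
          ← ENNReal.ofReal_mul hβa.le, Real.div_rpow hb0.le hTc.le, Real.rpow_neg hTc.le,
          abs_of_pos hβa]
        congr 1
        field_simp
  refine (toReal_sub_toReal_le (rescaledEnergy_Ioo_lt_top hW ha (by linarith) hv T)
    (by positivity) hfinal).trans ?_
  rw [add_mul, one_mul]
  have : 0 ≤ (b / (T - c)) ^ (2 * s) := by positivity
  linarith

theorem vanishing_tails_zero {s : ℝ} (hs : 1 / 2 < s) {αW βW αa βa : ℝ} (hαa : 0 < αa) (M : ℝ) :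
    ∃ C : ℝ, 0 < C ∧ ∀ W : ℝ → ℝ, IsDoubleWell W αW βW → ∀ a : ℝ → ℝ → ℝ,
      IsHomogenizationKernel a αa βa → ∀ v : ℝ → ℝ, MemHLoc 0 s v → ∀ σ η b c : ℝ,
      σ = 1 ∨ σ = -1 → η < 1 → 1 < b → b < c →
      (∀ᵐ x : ℝ, c ≤ |x| → v x = σ * Real.sign x) →
      (∀ᵐ x : ℝ, b ≤ |x| → |(|v x| - 1)| ≤ η) →
      rescaledEnergy W a 0 s v univ < ⊤ ∧
      ((rescaledEnergy W a 0 s v univ).toReal ≤ M → ∀ T : ℝ, c < T →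
        (rescaledEnergy W a 0 s v univ).toReal - (rescaledEnergy W a 0 s v (Ioo (-T) T)).toReal
          ≤ C * (c / (T - c)) ^ (2 * s) + C / T ^ (2 * s - 1)) := by
  have hs0 : 0 < s := by linarith
  have hs1 : 0 < 2 * s - 1 := by linarith
  set A : ℝ := 4 * 3 ^ (1 + 2 * s) * αa⁻¹ * |M| + 52 with hA
  have hA0 : 0 < A := by positivity
  set C₁ : ℝ := 2 * |βa| * A / s with hC₁
  set C₂ : ℝ := 16 * |βa| / (s * (2 * s - 1)) with hC₂
  have hC₁0 : 0 ≤ C₁ := by positivity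
  have hC₂0 : 0 ≤ C₂ := by positivity
  refine ⟨C₁ + C₂ + 1, by positivity, ?_⟩
  intro W hW a ha v hv σ η b c hσ hη hb hbc h1 h2
  obtain ⟨g, hgm, hg, hvg⟩ := hv.exists_measurable_weakDeriv
  have hve : v =ᵐ[volume] g := hvg.self_of_zero.ae_eq hvg
  have hc0 : 0 < c := by linarith
  have hβa := ha.pos_upper
  have hks : 1 / 2 < ((0 : ℕ) : ℝ) + s := by simpa using hs
  have hg0 : ∀ᵐ x : ℝ, c ≤ |x| → g x = σ * Real.sign x := by
    filter_upwards [h1, hve] with x hx hxe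
    rwa [← hxe]
  have main : ∀ T, c < T → rescaledEnergy W a 0 s v univ ≤
      rescaledEnergy W a 0 s v (Ioo (-T) T) + ENNReal.ofReal βa *
        (2 * (ENNReal.ofReal ((T - c) ^ (-(2 * s)) / s) *
          (∫⁻ x in Ioo (-c) c, ENNReal.ofReal (2 * (g x ^ 2 + 1))) +
          ENNReal.ofReal (8 / (s * (2 * s - 1)) * T ^ (1 - 2 * s)))) := by
    intro T hT
    refine (rescaledEnergy_univ_le hW ha hg hσ hc0 hT.le h1).trans ?_
    gcongr
    exact tail_le_of_eq_sign hs hc0 hT hσ hgm hg0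
  have hfin : rescaledEnergy W a 0 s v univ < ⊤ := by
    have hint : ∫⁻ x in Ioo (-c) c, ENNReal.ofReal (2 * (g x ^ 2 + 1)) < ⊤ := by
      have e : ∀ x, ENNReal.ofReal (2 * (g x ^ 2 + 1)) = 2 * ‖g x‖ₑ ^ 2 + 2 := fun x => by
        rw [enorm_sq_eq_ofReal, mul_add, ENNReal.ofReal_add (by positivity) (by norm_num),
          ENNReal.ofReal_mul (by norm_num)]
        simp
      simp_rw [e]
      rw [lintegral_add_right _ measurable_const, lintegral_const_mul _ (by fun_prop),
        lintegral_const, Measure.restrict_apply_univ, Real.volume_Ioo]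
      exact ENNReal.add_lt_top.2 ⟨ENNReal.mul_lt_top (by simp) (hv.lintegral_sq_lt_top hg c),
        ENNReal.mul_lt_top (by simp) ENNReal.ofReal_lt_top⟩
    exact (main (c + 1) (by linarith)).trans_lt (ENNReal.add_lt_top.2
      ⟨rescaledEnergy_Ioo_lt_top hW ha hks hv _,
        ENNReal.mul_lt_top ENNReal.ofReal_lt_top (ENNReal.mul_lt_top (by simp)
          (ENNReal.add_lt_top.2 ⟨ENNReal.mul_lt_top ENNReal.ofReal_lt_top hint,
            ENNReal.ofReal_lt_top⟩))⟩)
  refine ⟨hfin, fun hM T hT => ?_⟩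
  have hTc : 0 < T - c := by linarith
  have hT0 : 0 < T := by linarith
  have hX : rescaledEnergy W a 0 s v univ ≤ ENNReal.ofReal |M| := by
    rw [← ENNReal.ofReal_toReal hfin.ne]
    exact ENNReal.ofReal_le_ofReal (hM.trans (le_abs_self M))
  have hL : ∫⁻ x in Ioo (-c) c, ENNReal.ofReal (2 * (g x ^ 2 + 1)) ≤
      ENNReal.ofReal (A * c ^ (2 * s)) := by
    refine (lintegral_sq_add_one_le_rescaledEnergy (W := W) hs ha hgm hg hve hη hb hbc
      h2).trans ((add_le_add_left (mul_le_mul_right hX _) _).trans (le_of_eq ?_))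
    rw [← ENNReal.ofReal_mul (by positivity), ← ENNReal.ofReal_add (by positivity) (by positivity),
      hA]
    congr 1; ring
  have hfinal : rescaledEnergy W a 0 s v univ ≤ rescaledEnergy W a 0 s v (Ioo (-T) T) +
      ENNReal.ofReal (C₁ * (c / (T - c)) ^ (2 * s) + C₂ / T ^ (2 * s - 1)) := by
    refine (main T hT).trans ?_
    gcongr
    calc ENNReal.ofReal βa * (2 * (ENNReal.ofReal ((T - c) ^ (-(2 * s)) / s) *
          (∫⁻ x in Ioo (-c) c, ENNReal.ofReal (2 * (g x ^ 2 + 1))) +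
          ENNReal.ofReal (8 / (s * (2 * s - 1)) * T ^ (1 - 2 * s))))
        ≤ ENNReal.ofReal βa * (2 * (ENNReal.ofReal ((T - c) ^ (-(2 * s)) / s) *
          ENNReal.ofReal (A * c ^ (2 * s)) +
          ENNReal.ofReal (8 / (s * (2 * s - 1)) * T ^ (1 - 2 * s)))) := by gcongr
      _ = _ := by
        rw [← ENNReal.ofReal_mul (by positivity),
          ← ENNReal.ofReal_add (by positivity) (by positivity),
          ← ENNReal.ofReal_ofNat, ← ENNReal.ofReal_mul (by norm_num),
          ← ENNReal.ofReal_mul hβa.le, Real.div_rpow hc0.le hTc.le, Real.rpow_neg hTc.le,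
          hC₁, hC₂, abs_of_pos hβa, show 1 - 2 * s = -(2 * s - 1) by ring, Real.rpow_neg hT0.le]
        congr 1
        field_simp
        ring
  refine (toReal_sub_toReal_le (rescaledEnergy_Ioo_lt_top hW ha hks hv T)
    (by positivity) hfinal).trans ?_
  gcongr <;> linarith

end

theorem lemma4p3 (k : ℕ) (s : ℝ) (hs0 : 0 < s) (hs1 : s < 1) (hks : 1 / 2 < (k : ℝ) + s)
    (αW βW αa βa η ρ M : ℝ) (hη0 : 0 < η) (hη1 : η < 1) (hρ : 0 < ρ) :
    ∃ C : ℝ, 0 < C ∧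
      ∀ W : ℝ → ℝ, IsDoubleWell W αW βW →
      η < sInf ((fun z : ℝ => √(W z)) '' {z : ℝ | 2 < |z|}) →
      ∀ a : ℝ → ℝ → ℝ, IsHomogenizationKernel a αa βa →
      ∀ v : ℝ → ℝ, MemHLoc k s v →
      ∀ σ : ℝ, σ = 1 ∨ σ = -1 →
      ∀ c' c'' : ℝ, 1 < c'' → c'' < c' →
      (∀ᵐ x : ℝ, c' ≤ |x| → v x = σ * Real.sign x) →
      (∀ᵐ x : ℝ, c'' ≤ |x| → |(|v x| - 1)| ≤ η) →
      rescaledEnergy W a k s v univ < ⊤ ∧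
      (ρ * (rescaledEnergy W a k s v univ).toReal ≤ c'' →
        (rescaledEnergy W a k s v univ).toReal ≤ M →
        ∀ T : ℝ, max c' (3 * c'') < T →
          (1 ≤ k →
            (rescaledEnergy W a k s v univ).toReal
                - (rescaledEnergy W a k s v (Ioo (-T) T)).toReal
              ≤ C * (c'' / (T - c')) ^ (2 * s)) ∧
          (k = 0 →
            (rescaledEnergy W a k s v univ).toReal
                - (rescaledEnergy W a k s v (Ioo (-T) T)).toReal
              ≤ C * (c' / (T - c')) ^ (2 * s) + C / T ^ (2 * s - 1))) := by
  -- The constant must exist before any `W` or `a` is given. If αW or αa is not positive, no such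
  -- pair exists and any constant works.
  by_cases hpos : 0 < αW ∧ 0 < αa
  swap
  · exact ⟨1, one_pos, fun W hW _ a ha => absurd ⟨hW.pos_lower, ha.pos_lower⟩ hpos⟩
  obtain ⟨hαW, hαa⟩ := hpos
  rcases Nat.eq_zero_or_pos k with rfl | hk
  · obtain ⟨C, hC, H⟩ := vanishing_tails_zero (s := s) (by simpa using hks) (αW := αW) (βW := βW)
      (βa := βa) hαa M
    refine ⟨C, hC, fun W hW _ a ha v hv σ hσ c' c'' h1 h2 hc hc2 => ?_⟩
    obtain ⟨hfin, h⟩ := H W hW a ha v hv σ η c'' c' hσ hη1 h1 h2 hc hc2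
    refine ⟨hfin, fun _ hM T hT => ⟨fun h0 => absurd h0 (by norm_num), fun _ => ?_⟩⟩
    exact h hM T ((le_max_left _ _).trans_lt hT)
  · obtain ⟨C, hC, H⟩ := vanishing_tails_of_pos hk hs0 (βW := βW) (βa := βa) hαW hαa M
    refine ⟨C, hC, fun W hW _ a ha v hv σ hσ c' c'' h1 h2 hc hc2 => ?_⟩
    obtain ⟨hfin, h⟩ := H W hW a ha v hv σ η c'' c' hσ hη1 h1 h2 hc hc2
    refine ⟨hfin, fun _ hM T hT => ⟨fun _ => ?_, fun h0 => absurd h0 hk.ne'⟩⟩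
    exact h hM T ((le_max_left _ _).trans_lt hT)
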